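/- Consider $\mathbb H^1=\mathbb R^3$ with the left-invariant fields $X_1=\partial_x-\frac y2\partial_t$, $X_2=\partial_y+\frac x2\partial_t$, $T=\partial_t$ and the Riemannian metric for which they are orthonormal. Let $S\subset\mathbb H^1$ be an oriented $C^3$ surface: near each of its points $S$ is the zero set of a $C^3$ function $\varphi$ without critical points, and $S$ carries a normal field $N$ with $N=\nabla\varphi=pX_1+q X_2+\omega T$ on $S$, where $p=X_1\varphi$, $q=X_2\varphi$, $\omega=T\varphi$. Assume that the characteristic locus $\Sigma(S)=\{g\in S: T_gS=\mathrm{span}(X_1(g),X_2(g))\}$ is empty. Put $W=\sqrt{p^2+q^2}$, $\bar p=p/W$, $\bar q=q/W$, $\bar\omega=\omega/W$, $\nu_H=Y=\bar pX_1+\bar qX_2$, $Z=\bar qX_1-\bar pX_2$, and $$\mathcal A=(\bar pT\bar q-\bar qT\bar p)+\bar\omega(\bar qY\bar p-\bar pY\bar q)+\bar\omega^2,$$ where the derivatives are taken of the extensions of $\bar p,\bar q$ off $S$ given by a local defining function $\varphi$ (the value of $\mathcal A$ on $S$ does not depend on $\varphi$). On a surface let $d\sigma_H=\frac{W}{|N|}\,d\sigma$,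 with $d\sigma$ the Riemannian surface measure, and let $P_H(E)=\int_E d\sigma_H$. Let $h\in C^2_0(S)$, that is, $h$ is the restriction to $S$ of a $C^2$ function on $\mathbb R^3$ and vanishes on $S$ outside a compact set $K\subset S$. For $E\subset S$ and $\lambda\in\mathbb R$ let $E^\lambda=\{g+\lambda h(g)\nu_H(g): g\in E\}$. Let $E$ be a Borel set with $K\subset E\subset S$ and $P_H(E)<\infty$ (for instance $E=S$, if $P_H(S)<\infty$). Then $P_H(E^\lambda)$, computed on the surface $S^\lambda$, is finite for all $\lambda$ close to $0$ and is twice differentiable in $\lambda$ at $0$, the function $(Zh)^2+h^2(2\mathcal A-\bar\omega^2)$ is $\sigma_H$-integrable on $S$, and $$\frac{d^2}{d\lambda^2}\Big|_{\lambda=0}P_H(E^\lambda)=\int_S\Big\{(Zh)^2+h^2\big(2\mathcal A-\bar\omega^2\big)\Big\}\,d\sigma_H=\int_S\Big\{(Zh)^2+h^2\big[2(\bar pT\bar q-\bar qT\bar p)+2\bar\omega(\bar qY\bar p-\bar pY\bar q)+\bar\omega^2\big]\Big\}\,d\sigma_H .$$ -/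

import Mathlib

open MeasureTheory Filter Topology Set

noncomputable section

/-- The underlying space `ℝ³` of the first Heisenberg group, with points `g = (x, y, t)` and the
group law `(x,y,t) ∘ (x',y',t') = (x + x', y + y', t + t' + (x y' - x' y) / 2)`. -/
abbrev Heis : Type := ℝ × ℝ × ℝ

namespace Heis

/-- The left-invariant field `X₁ = ∂_x - (y/2) ∂_t`. -/
def X₁ (g : Heis) : Heis := (1, 0, -(g.2.1 / 2))

/-- The left-invariant field `X₂ = ∂_y + (x/2) ∂_t`. -/
def X₂ (g : Heis) : Heis := (0, 1, g.1 / 2)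

/-- The left-invariant field `T = ∂_t`. -/
def T (_g : Heis) : Heis := (0, 0, 1)

/-- The derivative `V f` of a function `f` along a vector field `V`. -/
def along (V : Heis → Heis) (f : Heis → ℝ) (g : Heis) : ℝ := fderiv ℝ f g (V g)

/-- The horizontal plane `H_g`, spanned by `X₁` and `X₂`. -/
def horizontal (g : Heis) : Submodule ℝ Heis := Submodule.span ℝ {X₁ g, X₂ g}

/-- The components of a vector `v` at `g` in the frame `X₁, X₂, T`:
`v = (coords g v 0) X₁ + (coords g v 1) X₂ + (coords g v 2) T`.
The left-invariant Riemannian metric is the one for which this frame is orthonormal, so it is the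
standard inner product of these components. -/
def coords (g v : Heis) : Fin 3 → ℝ :=
  ![v.1, v.2.1, v.2.2 + (g.2.1 * v.1 - g.1 * v.2.1) / 2]

/-- The Riemannian gradient `(X₁ f, X₂ f, T f)`, in the frame `X₁, X₂, T`. -/
def grad (f : Heis → ℝ) (g : Heis) : Fin 3 → ℝ :=
  ![along X₁ f g, along X₂ f g, along T f g]

/-- The Riemannian length of the vector with frame components `n`. -/
def len (n : Fin 3 → ℝ) : ℝ := √(n 0 ^ 2 + n 1 ^ 2 + n 2 ^ 2)

/-- The length `W` of the horizontal part of the vector with frame components `n`. -/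
def hlen (n : Fin 3 → ℝ) : ℝ := √(n 0 ^ 2 + n 1 ^ 2)

/-! ### Surface measure and `H`-perimeter measure -/

/-- A local parametrization of (a piece of) `M ⊆ ℝ³`: an injective `C¹` immersion of an open
subset of the plane, with values in `M`. -/
structure Chart (M : Set Heis) where
  /-- the parameter domain -/
  dom : Set (ℝ × ℝ)
  /-- the parametrization -/
  toFun : ℝ × ℝ → Heis
  isOpen_dom : IsOpen dom
  contDiffOn : ContDiffOn ℝ 1 toFun dom
  injOn : InjOn toFun dom
  immersion : ∀ u ∈ dom, Function.Injective (fderiv ℝ toFun u)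
  mapsTo : MapsTo toFun dom M

/-- The normal `ψ_u × ψ_v` of a parametrization `ψ`, the vector product being the one of the
left-invariant Riemannian metric. Its Riemannian length is the Riemannian area element. -/
def Chart.normal {M : Set Heis} (c : Chart M) (u : ℝ × ℝ) : Fin 3 → ℝ :=
  crossProduct (coords (c.toFun u) (fderiv ℝ c.toFun u (1, 0)))
    (coords (c.toFun u) (fderiv ℝ c.toFun u (0, 1)))

/-- The `H`-perimeter measure `dσ_H = (W / |N|) dσ` of the part of `M` parametrized by `c`. Here
`dσ = |N| du dv` is the Riemannian surface measure, `N` the normal of the parametrization, and `W`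
the length of the horizontal part of `N`. -/
def Chart.hPerimeter {M : Set Heis} (c : Chart M) : Measure Heis :=
  Measure.map c.toFun ((volume.restrict c.dom).withDensity fun u =>
    ENNReal.ofReal (hlen (c.normal u) / len (c.normal u) * len (c.normal u)))

/-- The `H`-perimeter measure `σ_H` of a surface `M`. On an embedded surface the measures of
the local parametrizations agree on overlaps, that is, each of them is the restriction of one
measure on `M` to the image of the parametrization; their supremum is this measure. -/
def hPerimeter (M : Set Heis) : Measure Heis := ⨆ c : Chart M, c.hPerimeter

/-! ### The frame `Z, Y, T` attached to a normal field

In this section `n` is a (non-unit) normal field `p X₁ + q X₂ + ω T`, given by its components. -/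

/-- `p̄ = p / W`. -/
def pbar (n : Heis → Fin 3 → ℝ) (g : Heis) : ℝ := n g 0 / hlen (n g)

/-- `q̄ = q / W`. -/
def qbar (n : Heis → Fin 3 → ℝ) (g : Heis) : ℝ := n g 1 / hlen (n g)

/-- `ω̄ = ω / W`. -/
def ombar (n : Heis → Fin 3 → ℝ) (g : Heis) : ℝ := n g 2 / hlen (n g)

/-- The horizontal Gauss map `Y = ν_H = p̄ X₁ + q̄ X₂`. -/
def Y (n : Heis → Fin 3 → ℝ) (g : Heis) : Heis := pbar n g • X₁ g + qbar n g • X₂ g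

/-- The horizontal tangent field `Z = ν_H^⊥ = q̄ X₁ - p̄ X₂`. -/
def Z (n : Heis → Fin 3 → ℝ) (g : Heis) : Heis := qbar n g • X₁ g - pbar n g • X₂ g

/-- `p̄ T q̄ - q̄ T p̄`. -/
def twistT (n : Heis → Fin 3 → ℝ) (g : Heis) : ℝ :=
  pbar n g * along T (qbar n) g - qbar n g * along T (pbar n) g

/-- `q̄ Y p̄ - p̄ Y q̄`. -/
def twistY (n : Heis → Fin 3 → ℝ) (g : Heis) : ℝ :=
  qbar n g * along (Y n) (pbar n) g - pbar n g * along (Y n) (qbar n) g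

/-- `𝒜 = (p̄ T q̄ - q̄ T p̄) + ω̄ (q̄ Y p̄ - p̄ Y q̄) + ω̄²`. -/
def calA (n : Heis → Fin 3 → ℝ) (g : Heis) : ℝ :=
  twistT n g + ombar n g * twistY n g + ombar n g ^ 2

/-! ### Oriented surfaces -/

/-- `φ` is a `C^k` defining function on the open set `O` of the surface `S` with normal field
`N`. -/
structure IsDefining (k : WithTop ℕ∞) (S : Set Heis) (N : Heis → Fin 3 → ℝ) (O : Set Heis)
    (φ : Heis → ℝ) : Prop where
  isOpen : IsOpen O
  contDiffOn : ContDiffOn ℝ k φ O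
  grad_ne_zero : ∀ g ∈ O, grad φ g ≠ 0
  inter_eq : S ∩ O = {g ∈ O | φ g = 0}
  normal_eq : ∀ g ∈ S ∩ O, N g = grad φ g

/-- An oriented `C^k` surface: a subset of `ℝ³` with a (non-unit) normal field `N`, which near
each of its points is the zero set of a `C^k` function `φ` without critical points such that
`N = ∇φ`. Only the values of `N` on the surface matter. -/
structure OrientedSurface (k : WithTop ℕ∞) where
  /-- the set of points of the surface -/
  carrier : Set Heis
  /-- the components `p, q, ω` of the normal field in the frame `X₁, X₂, T` -/
  N : Heis → Fin 3 → ℝ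
  exists_defining : ∀ g ∈ carrier, ∃ O φ, g ∈ O ∧ IsDefining k carrier N O φ

namespace OrientedSurface

variable {k : WithTop ℕ∞}

open Classical in
/-- A defining function of the surface near the point `g` of the surface. -/
def defining (S : OrientedSurface k) (g : Heis) : Heis → ℝ :=
  if hg : g ∈ S.carrier then (S.exists_defining g hg).choose_spec.choose else 0

/-- The extension `∇φ` of the normal field to a neighbourhood of the point `g`, by a local
defining function `φ`. -/
def normalNear (S : OrientedSurface k) (g : Heis) : Heis → Fin 3 → ℝ := grad (S.defining g)

/-- The tangent plane at a point of the surface. -/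
def tangent (S : OrientedSurface k) (g : Heis) : Submodule ℝ Heis :=
  LinearMap.ker (fderiv ℝ (S.defining g) g).toLinearMap

/-- The characteristic locus `Σ(S)`: the points at which the tangent plane is horizontal. -/
def charLocus (S : OrientedSurface k) : Set Heis :=
  {g ∈ S.carrier | S.tangent g = horizontal g}

/-- The function `𝒜` on the surface. The derivatives of `p̄` and `q̄` are those of the extensions
of `p̄` and `q̄` by a local defining function. They enter only through the tangential operator
`T - ω̄ Y`, so the value does not depend on the choice of the defining function. -/
def calA (S : OrientedSurface k) (g : Heis) : ℝ := Heis.calA (S.normalNear g) g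

/-- The integrand `(Zh)² + h² (2 𝒜 - ω̄²)`. -/
def integrand (S : OrientedSurface k) (h : Heis → ℝ) (g : Heis) : ℝ :=
  along (Z S.N) h g ^ 2 + h g ^ 2 * (2 * S.calA g - ombar S.N g ^ 2)

/-- The integrand `(Zh)² + h² [2 (p̄ T q̄ - q̄ T p̄) + 2 ω̄ (q̄ Y p̄ - p̄ Y q̄) + ω̄²]`. -/
def integrand' (S : OrientedSurface k) (h : Heis → ℝ) (g : Heis) : ℝ :=
  along (Z S.N) h g ^ 2 + h g ^ 2 * (2 * twistT (S.normalNear g) g +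
    2 * ombar S.N g * twistY (S.normalNear g) g + ombar S.N g ^ 2)

/-- The deformation `g ↦ g + s h(g) ν_H(g)` of the surface. -/
def deform (S : OrientedSurface k) (h : Heis → ℝ) (s : ℝ) (g : Heis) : Heis :=
  g + (s * h g) • Y S.N g

/-- The `H`-perimeter `P_H(E^s)` of the part `E^s = {g + s h(g) ν_H(g) | g ∈ E}` of the deformed
surface `S^s = {g + s h(g) ν_H(g) | g ∈ S}`. -/
def deformedPerimeter (S : OrientedSurface k) (h : Heis → ℝ) (E : Set Heis) (s : ℝ) : ENNReal :=
  hPerimeter (S.deform h s '' S.carrier) (S.deform h s '' E)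

end OrientedSurface

/-- The real function `V` is differentiable near `x`, and its derivative is differentiable at `x`
with derivative `c`. -/
def HasSecondDerivAt (V : ℝ → ℝ) (c x : ℝ) : Prop :=
  ∃ V' : ℝ → ℝ, (∀ᶠ s in 𝓝 x, HasDerivAt V (V' s) s) ∧ HasDerivAt V' c x

end Heis

end

open scoped Manifold ContDiff ENNReal

/-! The field `h ν_H` is given on `S` by the components `a = h p̄` and `b = h q̄`, which extend to
compactly supported `C²` functions on `ℝ³`. For small `s` the map `F_s(g) = g + s (a X₁ + b X₂)` is
then a diffeomorphism of `ℝ³` that agrees on `S` with the deformation, so `σ_H` on the deformed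
surface is computed by transporting charts.

Where `W ≠ 0` the tangent plane is spanned by `Z` and `τ = T - ω̄ Y`, and `Z × τ = -N / W` has
horizontal length 1. Hence the density of the transported `H`-perimeter with respect to `σ_H` is the
horizontal length of `DF_s Z × DF_s τ`. Its two horizontal components are cubic polynomials in `s`
whose coefficients are continuous on `S`; the density is `jac`, the root of the sum of their
squares. It is 1 at `s = 0`, and 1 off `K` for every `s`. So the perimeter of `E^s` is a constant
plus the integral of `jac` over `K`, and both derivatives pass under the integral by compactness
(`eventually_deformedPerimeter_eq`, `hasSecondDerivAt_integral_sqrt_normSq`).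

With `κ = p̄ τq̄ - q̄ τp̄` the second derivative of the density at 0 is `(Zh + ω̄ h)² + h² κ`,
whereas the claimed integrand is `(Zh)² + h² (2κ + ω̄²)`. The difference `h² κ - 2 ω̄ h Zh` is the
value on `(Z, τ)` of the exact form `d(h² p̄) ∧ dx + d(h² q̄) ∧ dy` (`second_variation_pointwise`).
Its integral vanishes by Stokes' theorem (`integral_bracket_eq_zero`), which is proved in single
charts and globalized by a partition of unity.

As `hPerimeter` is a supremum over all charts, it has to be identified first: on a patch it is the
measure of one chart (`hPerimeter_restrict_patch`), and under a diffeomorphism it transforms by the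
Jacobian (`hPerimeter_image`). -/

namespace Heis

/-! ### The frame on a non-characteristic tangent plane -/

/-- The transversal tangent field `T - ω̄ Y`. Together with `Z` it spans the tangent planes. -/
noncomputable def tanT (n : Heis → Fin 3 → ℝ) (g : Heis) : Heis := T g - ombar n g • Y n g

/-- The frame components, as a linear map. -/
noncomputable def coordsLin (g : Heis) : Heis →ₗ[ℝ] (Fin 3 → ℝ) where
  toFun := coords g
  map_add' v w := by
    ext i; fin_cases i <;> simp [coords]; ring
  map_smul' r v := by
    ext i; fin_cases i <;> simp [coords]; ring

theorem coordsLin_apply (g v : Heis) : coordsLin g v = coords g v := rfl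

theorem frame_expansion (g v : Heis) :
    v = coords g v 0 • X₁ g + coords g v 1 • X₂ g + coords g v 2 • T g := by
  ext <;> simp [coords, X₁, X₂, T]; ring

theorem hlen_sq (n : Fin 3 → ℝ) : hlen n ^ 2 = n 0 ^ 2 + n 1 ^ 2 := by
  rw [hlen, Real.sq_sqrt (by positivity)]

theorem hlen_smul (r : ℝ) (n : Fin 3 → ℝ) : hlen (r • n) = |r| * hlen n := by
  simp only [hlen, Pi.smul_apply, smul_eq_mul]
  rw [← Real.sqrt_sq_eq_abs, ← Real.sqrt_mul (sq_nonneg r)]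
  ring_nf

theorem hlen_div_len_mul_len (n : Fin 3 → ℝ) : hlen n / len n * len n = hlen n := by
  by_cases hl : len n = 0
  · rw [len, Real.sqrt_eq_zero (by positivity)] at hl
    have : hlen n = 0 := by
      rw [hlen, Real.sqrt_eq_zero (by positivity)]
      nlinarith [sq_nonneg (n 0), sq_nonneg (n 1), sq_nonneg (n 2)]
    simp [this]
  · field_simp

theorem pbar_sq_add_qbar_sq {n : Heis → Fin 3 → ℝ} {g : Heis} (hW : hlen (n g) ≠ 0) :
    pbar n g ^ 2 + qbar n g ^ 2 = 1 := by
  rw [pbar, qbar, div_pow, div_pow, ← add_div, ← hlen_sq]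
  exact div_self (pow_ne_zero 2 hW)

section Frame

variable (n : Heis → Fin 3 → ℝ) (g : Heis)

@[simp] theorem Z_fst : (Z n g).1 = qbar n g := by simp [Z, X₁, X₂]
@[simp] theorem Z_snd_fst : (Z n g).2.1 = -pbar n g := by simp [Z, X₁, X₂]
@[simp] theorem Z_snd_snd :
    (Z n g).2.2 = -(g.2.1 / 2) * qbar n g - g.1 / 2 * pbar n g := by
  simp [Z, X₁, X₂]; ring
@[simp] theorem tanT_fst : (tanT n g).1 = -(ombar n g * pbar n g) := by
  simp [tanT, Y, T, X₁, X₂]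
@[simp] theorem tanT_snd_fst : (tanT n g).2.1 = -(ombar n g * qbar n g) := by
  simp [tanT, Y, T, X₁, X₂]
@[simp] theorem tanT_snd_snd : (tanT n g).2.2 =
    1 - ombar n g * (-(g.2.1 / 2) * pbar n g + g.1 / 2 * qbar n g) := by
  simp [tanT, Y, T, X₁, X₂]
  left; ring

theorem coords_Z : coords g (Z n g) = ![qbar n g, -pbar n g, 0] := by
  simp only [coords, Z_fst, Z_snd_fst, Z_snd_snd]
  congr 3; ring

theorem coords_tanT :
    coords g (tanT n g) = ![-(ombar n g * pbar n g), -(ombar n g * qbar n g), 1] := by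
  simp only [coords, tanT_fst, tanT_snd_fst, tanT_snd_snd]
  congr 3; ring

variable {n g}

/-- Here `Z × (T - ω̄ Y) = -N / W`, with horizontal part `-ν_H`. So `σ_H` is the area for which this
frame spans a unit cell. -/
theorem hlen_cross_coords_frame (hW : hlen (n g) ≠ 0) :
    hlen (crossProduct (coords g (Z n g)) (coords g (tanT n g))) = 1 := by
  have h1 := pbar_sq_add_qbar_sq hW
  rw [coords_Z, coords_tanT, hlen, cross_apply]
  simp only [Matrix.cons_val_zero, Matrix.cons_val_one, Matrix.cons_val]
  rw [Real.sqrt_eq_one]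
  linear_combination h1

/-- A vector orthogonal to the normal is a combination of `Z` and `T - ω̄ Y`. -/
theorem eq_of_normal_orthogonal (hW : hlen (n g) ≠ 0) {v : Heis}
    (hv : coords g v 0 * n g 0 + coords g v 1 * n g 1 + coords g v 2 * n g 2 = 0) :
    v = (qbar n g * coords g v 0 - pbar n g * coords g v 1) • Z n g
      + coords g v 2 • tanT n g := by
  have h1 := pbar_sq_add_qbar_sq hW
  have h2 : coords g v 0 * pbar n g + coords g v 1 * qbar n g + coords g v 2 * ombar n g = 0 := by
    simp only [pbar, qbar, ombar]
    field_simp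
    linarith
  have e0 : v.1 = coords g v 0 := rfl
  have e1 : v.2.1 = coords g v 1 := rfl
  have e2 : v.2.2 = coords g v 2 - (g.2.1 * v.1 - g.1 * v.2.1) / 2 := by simp [coords]
  refine Prod.ext ?_ (Prod.ext ?_ ?_)
  · simp only [Prod.fst_add, Prod.smul_fst, smul_eq_mul, Z_fst, tanT_fst]
    rw [e0]
    linear_combination (-coords g v 0) * h1 + pbar n g * h2
  · simp only [Prod.fst_add, Prod.smul_fst, Prod.snd_add, Prod.smul_snd, smul_eq_mul,
      Z_snd_fst, tanT_snd_fst]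
    rw [e1]
    linear_combination (-coords g v 1) * h1 + qbar n g * h2
  · simp only [Prod.snd_add, Prod.smul_snd, smul_eq_mul,
      Z_snd_snd, tanT_snd_snd]
    rw [e2, e0, e1]
    linear_combination (g.2.1 / 2 * coords g v 0 - g.1 / 2 * coords g v 1) * h1
      - (g.2.1 / 2 * pbar n g - g.1 / 2 * qbar n g) * h2

end Frame

theorem cross_of_combination {E : Type*} [AddCommGroup E] [Module ℝ E]
    (M : E →ₗ[ℝ] (Fin 3 → ℝ)) (z t : E) (a b c d : ℝ) :
    crossProduct (M (a • z + b • t)) (M (c • z + d • t))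
      = (a * d - b * c) • crossProduct (M z) (M t) := by
  ext i
  fin_cases i <;> simp [cross_apply] <;> ring

theorem fderiv_eq_grad (φ : Heis → ℝ) (g v : Heis) :
    fderiv ℝ φ g v = coords g v 0 * grad φ g 0 + coords g v 1 * grad φ g 1
      + coords g v 2 * grad φ g 2 := by
  conv_lhs => rw [frame_expansion g v]
  simp [grad, along]

theorem contDiff_X₁ {k : WithTop ℕ∞} : ContDiff ℝ k X₁ := by
  unfold X₁; fun_prop
theorem contDiff_X₂ {k : WithTop ℕ∞} : ContDiff ℝ k X₂ := by
  unfold X₂; fun_prop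
theorem contDiff_T {k : WithTop ℕ∞} : ContDiff ℝ k T := by
  unfold T; fun_prop

theorem contDiffOn_grad {φ : Heis → ℝ} {O : Set Heis} (hO : IsOpen O)
    (hφ : ContDiffOn ℝ 3 φ O) : ContDiffOn ℝ 2 (grad φ) O := by
  have h1 : ContDiffOn ℝ 2 (fderiv ℝ φ) O := hφ.fderiv_of_isOpen hO (by norm_num)
  rw [contDiffOn_pi]
  intro i
  fin_cases i
  · exact h1.clm_apply contDiff_X₁.contDiffOn
  · exact h1.clm_apply contDiff_X₂.contDiffOn
  · exact h1.clm_apply contDiff_T.contDiffOn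

theorem contDiffAt_hlen {n : Heis → Fin 3 → ℝ} {g : Heis} {k : WithTop ℕ∞}
    (hn : ContDiffAt ℝ k n g) (hW : hlen (n g) ≠ 0) : ContDiffAt ℝ k (fun x => hlen (n x)) g := by
  rw [contDiffAt_pi] at hn
  refine ContDiffAt.sqrt (((hn 0).pow 2).add ((hn 1).pow 2)) ?_
  intro h0
  exact hW (by rw [hlen, h0, Real.sqrt_zero])

theorem contDiffAt_pbar {n : Heis → Fin 3 → ℝ} {g : Heis} {k : WithTop ℕ∞}
    (hn : ContDiffAt ℝ k n g) (hW : hlen (n g) ≠ 0) : ContDiffAt ℝ k (pbar n) g :=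
  (contDiffAt_pi.1 hn 0).div (contDiffAt_hlen hn hW) hW

theorem contDiffAt_qbar {n : Heis → Fin 3 → ℝ} {g : Heis} {k : WithTop ℕ∞}
    (hn : ContDiffAt ℝ k n g) (hW : hlen (n g) ≠ 0) : ContDiffAt ℝ k (qbar n) g :=
  (contDiffAt_pi.1 hn 1).div (contDiffAt_hlen hn hW) hW

theorem pbar_congr {n m : Heis → Fin 3 → ℝ} {g : Heis} (h : n g = m g) : pbar n g = pbar m g := by
  rw [pbar, pbar, h]
theorem qbar_congr {n m : Heis → Fin 3 → ℝ} {g : Heis} (h : n g = m g) : qbar n g = qbar m g := by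
  rw [qbar, qbar, h]
theorem ombar_congr {n m : Heis → Fin 3 → ℝ} {g : Heis} (h : n g = m g) :
    ombar n g = ombar m g := by
  rw [ombar, ombar, h]
theorem Y_congr {n m : Heis → Fin 3 → ℝ} {g : Heis} (h : n g = m g) : Y n g = Y m g := by
  rw [Y, Y, pbar_congr h, qbar_congr h]

/-! ### Non-characteristic oriented surfaces -/

namespace OrientedSurface

theorem defining_spec {k : WithTop ℕ∞} (S : OrientedSurface k) {g : Heis} (hg : g ∈ S.carrier) :
    ∃ O, g ∈ O ∧ IsDefining k S.carrier S.N O (S.defining g) := by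
  have h := (S.exists_defining g hg).choose_spec.choose_spec
  refine ⟨_, h.1, ?_⟩
  rw [defining, dif_pos hg]
  exact h.2

/-- If `W = 0`, the gradient is a nonzero multiple of `T`, so the kernel of `dφ` is the horizontal
plane and the point is characteristic. -/
theorem hlen_ne_zero {S : OrientedSurface 3} (hchar : S.charLocus = ∅) {g : Heis}
    (hg : g ∈ S.carrier) : hlen (S.N g) ≠ 0 := by
  intro h0
  obtain ⟨O, hgO, hO⟩ := S.defining_spec hg
  have hN := hO.normal_eq g ⟨hg, hgO⟩
  have hne := hO.grad_ne_zero g hgO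
  rw [hN, hlen, Real.sqrt_eq_zero (by positivity)] at h0
  have h00 : grad (S.defining g) g 0 = 0 := by
    nlinarith [sq_nonneg (grad (S.defining g) g 0), sq_nonneg (grad (S.defining g) g 1)]
  have h01 : grad (S.defining g) g 1 = 0 := by
    nlinarith [sq_nonneg (grad (S.defining g) g 0), sq_nonneg (grad (S.defining g) g 1)]
  have h02 : grad (S.defining g) g 2 ≠ 0 := by
    intro h2
    apply hne
    ext i; fin_cases i <;> assumption
  have : g ∈ S.charLocus := by
    refine ⟨hg, ?_⟩
    ext v
    rw [tangent, LinearMap.mem_ker, horizontal, Submodule.mem_span_pair]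
    change fderiv ℝ (S.defining g) g v = 0 ↔ _
    rw [fderiv_eq_grad, h00, h01]
    constructor
    · intro hv
      have hc : coords g v 2 = 0 := by
        rcases mul_eq_zero.1 (by linarith : coords g v 2 * grad (S.defining g) g 2 = 0) with h | h
        · exact h
        · exact absurd h h02
      refine ⟨coords g v 0, coords g v 1, ?_⟩
      conv_rhs => rw [frame_expansion g v, hc]
      simp
    · rintro ⟨r, s, rfl⟩
      have : coords g (r • X₁ g + s • X₂ g) 2 = 0 := by
        simp [coords, X₁, X₂]; ring
      rw [this]; ring
  rw [hchar] at this
  exact this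

variable {S : OrientedSurface 3}

theorem contDiffAt_defining {k : WithTop ℕ∞} {M O : Set Heis} {N : Heis → Fin 3 → ℝ}
    {φ : Heis → ℝ} (h : IsDefining k M N O φ) {g : Heis} (hg : g ∈ O) : ContDiffAt ℝ k φ g :=
  h.contDiffOn.contDiffAt (h.isOpen.mem_nhds hg)

theorem chart_differentiableAt {M : Set Heis} (c : Chart M) {u : ℝ × ℝ} (hu : u ∈ c.dom) :
    DifferentiableAt ℝ c.toFun u :=
  (c.contDiffOn.contDiffAt (c.isOpen_dom.mem_nhds hu)).differentiableAt (by norm_num)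

theorem chart_continuousAt {M : Set Heis} (c : Chart M) {u : ℝ × ℝ} (hu : u ∈ c.dom) :
    ContinuousAt c.toFun u := (chart_differentiableAt c hu).continuousAt

/-- A defining function vanishes identically along the chart, so its differential kills the
derivatives of the chart. -/
theorem fderiv_chart_eq (hchar : S.charLocus = ∅) (c : Chart S.carrier) {u : ℝ × ℝ}
    (hu : u ∈ c.dom) (w : ℝ × ℝ) :
    fderiv ℝ c.toFun u w =
      (qbar S.N (c.toFun u) * coords (c.toFun u) (fderiv ℝ c.toFun u w) 0
        - pbar S.N (c.toFun u) * coords (c.toFun u) (fderiv ℝ c.toFun u w) 1) • Z S.N (c.toFun u)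
      + coords (c.toFun u) (fderiv ℝ c.toFun u w) 2 • tanT S.N (c.toFun u) := by
  have hg : c.toFun u ∈ S.carrier := c.mapsTo hu
  obtain ⟨O, hgO, hO⟩ := S.defining_spec hg
  apply eq_of_normal_orthogonal (hlen_ne_zero hchar hg)
  rw [hO.normal_eq _ ⟨hg, hgO⟩, ← fderiv_eq_grad]
  have hφ := (contDiffAt_defining hO hgO).differentiableAt (by norm_num)
  have hz : (fun v => S.defining (c.toFun u) (c.toFun v)) =ᶠ[𝓝 u] fun _ => 0 := by
    filter_upwards [c.isOpen_dom.mem_nhds hu,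
      (chart_continuousAt c hu).preimage_mem_nhds (hO.isOpen.mem_nhds hgO)] with v hv hvO
    have : c.toFun v ∈ S.carrier ∩ O := ⟨c.mapsTo hv, hvO⟩
    rw [hO.inter_eq] at this
    exact this.2
  have h1 := hz.fderiv_eq (𝕜 := ℝ)
  have h2 : fderiv ℝ (fun v => S.defining (c.toFun u) (c.toFun v)) u
      = (fderiv ℝ (S.defining (c.toFun u)) (c.toFun u)).comp (fderiv ℝ c.toFun u) :=
    fderiv_comp u hφ (chart_differentiableAt c hu)
  rw [h2] at h1
  simpa using DFunLike.congr_fun h1 w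

/-- The Jacobian of a chart in the frame `Z, T - ω̄ Y`. -/
noncomputable def chartDet (S : OrientedSurface 3) (c : Chart S.carrier) (u : ℝ × ℝ) : ℝ :=
  (qbar S.N (c.toFun u) * coords (c.toFun u) (fderiv ℝ c.toFun u (1, 0)) 0
    - pbar S.N (c.toFun u) * coords (c.toFun u) (fderiv ℝ c.toFun u (1, 0)) 1)
      * coords (c.toFun u) (fderiv ℝ c.toFun u (0, 1)) 2
  - coords (c.toFun u) (fderiv ℝ c.toFun u (1, 0)) 2 *
    (qbar S.N (c.toFun u) * coords (c.toFun u) (fderiv ℝ c.toFun u (0, 1)) 0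
    - pbar S.N (c.toFun u) * coords (c.toFun u) (fderiv ℝ c.toFun u (0, 1)) 1)

theorem cross_fderiv_chart (hchar : S.charLocus = ∅) (c : Chart S.carrier) {u : ℝ × ℝ}
    (hu : u ∈ c.dom) (M : Heis →ₗ[ℝ] (Fin 3 → ℝ)) :
    crossProduct (M (fderiv ℝ c.toFun u (1, 0))) (M (fderiv ℝ c.toFun u (0, 1)))
      = chartDet S c u • crossProduct (M (Z S.N (c.toFun u))) (M (tanT S.N (c.toFun u))) := by
  conv_lhs => rw [fderiv_chart_eq hchar c hu (1, 0), fderiv_chart_eq hchar c hu (0, 1)]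
  rw [cross_of_combination, chartDet]

theorem hlen_normal_chart (hchar : S.charLocus = ∅) (c : Chart S.carrier) {u : ℝ × ℝ}
    (hu : u ∈ c.dom) : hlen (c.normal u) = |chartDet S c u| := by
  have := cross_fderiv_chart hchar c hu (coordsLin (c.toFun u))
  simp only [coordsLin_apply] at this
  rw [Chart.normal, this, hlen_smul,
    hlen_cross_coords_frame (hlen_ne_zero hchar (c.mapsTo hu)), mul_one]

theorem chart_bracket (hchar : S.charLocus = ∅) (c : Chart S.carrier) {u : ℝ × ℝ}
    (hu : u ∈ c.dom) (α β : Heis →L[ℝ] ℝ) :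
    α (fderiv ℝ c.toFun u (1, 0)) * β (fderiv ℝ c.toFun u (0, 1))
      - α (fderiv ℝ c.toFun u (0, 1)) * β (fderiv ℝ c.toFun u (1, 0))
      = chartDet S c u * (α (Z S.N (c.toFun u)) * β (tanT S.N (c.toFun u))
        - α (tanT S.N (c.toFun u)) * β (Z S.N (c.toFun u))) := by
  conv_lhs => rw [fderiv_chart_eq hchar c hu (1, 0), fderiv_chart_eq hchar c hu (0, 1)]
  simp only [map_add, map_smul, smul_eq_mul, chartDet]
  ring

/-- Cramer's rule without division. It places a multiple of `Z` in the range of the differential of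
the chart; the next lemma does the same for `T - ω̄ Y`. -/
theorem chartDet_smul_Z (hchar : S.charLocus = ∅) (c : Chart S.carrier) {u : ℝ × ℝ}
    (hu : u ∈ c.dom) : chartDet S c u • Z S.N (c.toFun u) = fderiv ℝ c.toFun u
      (coords (c.toFun u) (fderiv ℝ c.toFun u (0, 1)) 2,
        -coords (c.toFun u) (fderiv ℝ c.toFun u (1, 0)) 2) := by
  have e : ∀ r s : ℝ, fderiv ℝ c.toFun u (r, s) = r • fderiv ℝ c.toFun u (1, 0)
      + s • fderiv ℝ c.toFun u (0, 1) := by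
    intro r s
    rw [← map_smul, ← map_smul, ← map_add]; simp
  rw [e]
  conv_rhs =>
    arg 1; arg 2; rw [fderiv_chart_eq hchar c hu (1, 0)]
  conv_rhs =>
    arg 2; arg 2; rw [fderiv_chart_eq hchar c hu (0, 1)]
  rw [chartDet]
  module

theorem chartDet_smul_tanT (hchar : S.charLocus = ∅) (c : Chart S.carrier) {u : ℝ × ℝ}
    (hu : u ∈ c.dom) : chartDet S c u • tanT S.N (c.toFun u) = fderiv ℝ c.toFun u
      (-(qbar S.N (c.toFun u) * coords (c.toFun u) (fderiv ℝ c.toFun u (0, 1)) 0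
        - pbar S.N (c.toFun u) * coords (c.toFun u) (fderiv ℝ c.toFun u (0, 1)) 1),
        (qbar S.N (c.toFun u) * coords (c.toFun u) (fderiv ℝ c.toFun u (1, 0)) 0
        - pbar S.N (c.toFun u) * coords (c.toFun u) (fderiv ℝ c.toFun u (1, 0)) 1)) := by
  have e : ∀ r s : ℝ, fderiv ℝ c.toFun u (r, s) = r • fderiv ℝ c.toFun u (1, 0)
      + s • fderiv ℝ c.toFun u (0, 1) := by
    intro r s
    rw [← map_smul, ← map_smul, ← map_add]; simp
  rw [e]
  conv_rhs =>
    arg 1; arg 2; rw [fderiv_chart_eq hchar c hu (1, 0)]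
  conv_rhs =>
    arg 2; arg 2; rw [fderiv_chart_eq hchar c hu (0, 1)]
  rw [chartDet]
  module

/-- If the determinant vanished, injectivity of the differential would turn Cramer's rule into the
vanishing of the coefficients of the first partial derivative of the chart. -/
theorem chartDet_ne_zero (hchar : S.charLocus = ∅) (c : Chart S.carrier) {u : ℝ × ℝ}
    (hu : u ∈ c.dom) : chartDet S c u ≠ 0 := by
  intro h0
  have h1 := chartDet_smul_Z hchar c hu
  have h2 := chartDet_smul_tanT hchar c hu
  rw [h0, zero_smul, ← map_zero (fderiv ℝ c.toFun u)] at h1 h2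
  have h3 := congrArg Prod.snd (c.immersion u hu h1)
  have h4 := congrArg Prod.snd (c.immersion u hu h2)
  simp only [Prod.snd_zero] at h3 h4
  have h6 : fderiv ℝ c.toFun u (1, 0) = 0 := by
    rw [fderiv_chart_eq hchar c hu (1, 0), ← h4, neg_eq_zero.1 h3.symm]; simp
  rw [← map_zero (fderiv ℝ c.toFun u)] at h6
  have := congrArg Prod.fst (c.immersion u hu h6)
  simp at this

/-! ### Patches and tangential derivatives -/

/-- Near each of its points the surface is the image of a `C²` chart with connected domain, whose
inverse is the restriction of a linear map. -/
theorem exists_patch (hchar : S.charLocus = ∅) {g : Heis} (hg : g ∈ S.carrier) :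
    ∃ (O : Set Heis) (c : Chart S.carrier) (π : Heis →L[ℝ] ℝ × ℝ), IsOpen O ∧ g ∈ O ∧
      IsPreconnected c.dom ∧ ContDiffOn ℝ 2 c.toFun c.dom ∧ MapsTo c.toFun c.dom O ∧
      (∀ u ∈ c.dom, π (c.toFun u) = u) ∧
      ∀ x ∈ S.carrier ∩ O, π x ∈ c.dom ∧ c.toFun (π x) = x := by
  obtain ⟨O, hgO, hO⟩ := S.defining_spec hg
  set φ := S.defining g with hφdef
  have hW := hlen_ne_zero hchar hg
  have hφ := contDiffAt_defining hO hgO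
  let dx : Heis →L[ℝ] ℝ := ContinuousLinearMap.fst ℝ ℝ (ℝ × ℝ)
  let dy : Heis →L[ℝ] ℝ := (ContinuousLinearMap.fst ℝ ℝ ℝ).comp (ContinuousLinearMap.snd ℝ ℝ (ℝ × ℝ))
  let dt : Heis →L[ℝ] ℝ := (ContinuousLinearMap.snd ℝ ℝ ℝ).comp (ContinuousLinearMap.snd ℝ ℝ (ℝ × ℝ))
  -- The coordinates with respect to `Z` and `T - ω̄ Y`, frozen at `g`. They separate the vectors of
  -- the tangent plane at `g`, so `(φ, π)` has an invertible differential there.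
  let π : Heis →L[ℝ] ℝ × ℝ := (qbar S.N g • dx - pbar S.N g • dy).prod
    (dt + (g.2.1 / 2) • dx - (g.1 / 2) • dy)
  have hπ : ∀ v, π v = (qbar S.N g * coords g v 0 - pbar S.N g * coords g v 1, coords g v 2) := by
    intro v
    simp [π, dx, dy, dt, coords]; ring
  let Φ : Heis → Heis := fun x => (φ x, π x)
  have hΦ : ContDiffAt ℝ 3 Φ g := hφ.prodMk π.contDiff.contDiffAt
  let f' : Heis →L[ℝ] Heis := (fderiv ℝ φ g).prod π
  have hinj : Function.Injective (f' : Heis →ₗ[ℝ] Heis) := by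
    rw [injective_iff_map_eq_zero]
    intro v hv
    have h1 : fderiv ℝ φ g v = 0 := congrArg Prod.fst hv
    have h2 : π v = 0 := congrArg Prod.snd hv
    rw [hπ, Prod.mk_eq_zero] at h2
    rw [fderiv_eq_grad, ← hO.normal_eq g ⟨hg, hgO⟩] at h1
    rw [eq_of_normal_orthogonal hW h1, h2.1, h2.2]
    simp
  let E : Heis ≃L[ℝ] Heis := (LinearEquiv.ofInjectiveEndo _ hinj).toContinuousLinearEquiv
  have hE : (E : Heis →L[ℝ] Heis) = f' := ContinuousLinearMap.ext fun _ => rfl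
  have hderiv : HasFDerivAt Φ (E : Heis →L[ℝ] Heis) g := by
    rw [hE]
    exact (hφ.differentiableAt (by norm_num)).hasFDerivAt.prodMk π.hasFDerivAt
  let e := hΦ.toOpenPartialHomeomorph Φ hderiv (by norm_num)
  have heg : g ∈ e.source := hΦ.mem_toOpenPartialHomeomorph_source hderiv (by norm_num)
  have hecoe : ∀ x, e x = Φ x := fun x => rfl
  have hsymm : ContDiffAt ℝ 3 e.symm (Φ g) := hΦ.to_localInverse hderiv (by norm_num)
  have hφg : φ g = 0 := by
    have : g ∈ S.carrier ∩ O := ⟨hg, hgO⟩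
    rw [hO.inter_eq] at this
    exact this.2
  have hcont : ContinuousAt (fun u : ℝ × ℝ => ((0, u) : Heis)) (π g) := by fun_prop
  have hpt : ((0, π g) : Heis) = Φ g := by simp [Φ, hφg]
  have hev : ∀ᶠ y in 𝓝 (Φ g), y ∈ e.target ∧ ContDiffAt ℝ 3 e.symm y ∧ e.symm y ∈ O := by
    have h1 : e.symm (Φ g) = g := e.left_inv heg
    have h2 : ∀ᶠ y in 𝓝 (Φ g), e.symm y ∈ O :=
      hsymm.continuousAt.eventually_mem (by rw [h1]; exact hO.isOpen.mem_nhds hgO)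
    filter_upwards [e.open_target.mem_nhds (e.map_source heg), hsymm.eventually (by simp), h2]
      with y hy1 hy2 hy3 using ⟨hy1, hy2, hy3⟩
  rw [← hpt] at hev
  obtain ⟨r, hr, hball⟩ := Metric.eventually_nhds_iff_ball.1 (hcont.eventually hev)
  have hcd : ∀ u ∈ Metric.ball (π g) r, ContDiffAt ℝ 3 (fun u : ℝ × ℝ => e.symm (0, u)) u := by
    intro u hu
    exact ContDiffAt.comp u (hball u hu).2.1 (by fun_prop)
  have hinvΦ : ∀ u ∈ Metric.ball (π g) r, Φ (e.symm (0, u)) = (0, u) := fun u hu =>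
    e.right_inv (hball u hu).1
  have hπinv : ∀ u ∈ Metric.ball (π g) r, π (e.symm (0, u)) = u := fun u hu =>
    congrArg Prod.snd (hinvΦ u hu)
  let c : Chart S.carrier :=
    { dom := Metric.ball (π g) r
      toFun := fun u => e.symm (0, u)
      isOpen_dom := Metric.isOpen_ball
      contDiffOn := fun u hu => ((hcd u hu).of_le (by norm_num)).contDiffWithinAt
      injOn := by
        intro u hu v hv huv
        rw [← hπinv u hu, ← hπinv v hv]
        exact congrArg π huv
      immersion := by
        intro u hu
        have h1 : HasFDerivAt (fun u => π (e.symm (0, u)))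
            (π.comp (fderiv ℝ (fun u : ℝ × ℝ => e.symm (0, u)) u)) u :=
          π.hasFDerivAt.comp u ((hcd u hu).differentiableAt (by norm_num)).hasFDerivAt
        have h2 : HasFDerivAt (fun u => π (e.symm (0, u))) (ContinuousLinearMap.id ℝ (ℝ × ℝ)) u := by
          refine (hasFDerivAt_id u).congr_of_eventuallyEq ?_
          filter_upwards [Metric.isOpen_ball.mem_nhds hu] with v hv using hπinv v hv
        have h3 := h1.unique h2
        refine Function.LeftInverse.injective (g := π) fun w => ?_
        exact congrArg (fun l => l w) h3
      mapsTo := by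
        intro u hu
        have h1 : e.symm (0, u) ∈ {x ∈ O | φ x = 0} :=
          ⟨(hball u hu).2.2, congrArg Prod.fst (hinvΦ u hu)⟩
        rw [← hO.inter_eq] at h1
        exact h1.1 }
  refine ⟨e.source ∩ O ∩ π ⁻¹' Metric.ball (π g) r, c, π, ?_, ?_, ?_, ?_, ?_, hπinv, ?_⟩
  · exact (e.open_source.inter hO.isOpen).inter (Metric.isOpen_ball.preimage π.continuous)
  · exact ⟨⟨heg, hgO⟩, Metric.mem_ball_self hr⟩
  · exact (convex_ball _ _).isPreconnected
  · exact fun u hu => ((hcd u hu).of_le (by norm_num)).contDiffWithinAt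
  · intro u hu
    refine ⟨⟨e.map_target (hball u hu).1, (hball u hu).2.2⟩, ?_⟩
    exact (congrArg (· ∈ Metric.ball (π g) r) (hπinv u hu)).mpr hu
  · rintro x ⟨hxS, ⟨hxe, hxO⟩, hxπ⟩
    refine ⟨hxπ, ?_⟩
    have h0 : φ x = 0 := by
      have : x ∈ S.carrier ∩ O := ⟨hxS, hxO⟩
      rw [hO.inter_eq] at this
      exact this.2
    have h1 : ((0, π x) : Heis) = e x := by rw [hecoe]; simp [Φ, h0]
    change e.symm (0, π x) = x
    rw [h1, e.left_inv hxe]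

/-- Functions that agree on the surface near a point have the same tangential derivatives. -/
theorem fderiv_eq_of_eqOn (hchar : S.charLocus = ∅) {f₁ f₂ : Heis → ℝ} {g : Heis} {O : Set Heis}
    (hg : g ∈ S.carrier) (hO : O ∈ 𝓝 g) (h₁ : DifferentiableAt ℝ f₁ g)
    (h₂ : DifferentiableAt ℝ f₂ g) (heq : ∀ x ∈ S.carrier ∩ O, f₁ x = f₂ x) :
    fderiv ℝ f₁ g (Z S.N g) = fderiv ℝ f₂ g (Z S.N g) ∧
      fderiv ℝ f₁ g (tanT S.N g) = fderiv ℝ f₂ g (tanT S.N g) := by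
  obtain ⟨O', c, π, -, hgO', -, -, -, -, hc⟩ := exists_patch hchar hg
  obtain ⟨hu, hcu⟩ := hc g ⟨hg, hgO'⟩
  generalize π g = u at hu hcu
  subst hcu
  have h0 : (fun v => f₁ (c.toFun v)) =ᶠ[𝓝 u] fun v => f₂ (c.toFun v) := by
    filter_upwards [c.isOpen_dom.mem_nhds hu,
      (chart_continuousAt c hu).preimage_mem_nhds hO] with v hv hvO
    exact heq _ ⟨c.mapsTo hv, hvO⟩
  have hd := chart_differentiableAt c hu
  have h3 : (fderiv ℝ f₁ (c.toFun u)).comp (fderiv ℝ c.toFun u)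
      = (fderiv ℝ f₂ (c.toFun u)).comp (fderiv ℝ c.toFun u) := by
    rw [← fderiv_comp u h₁ hd, ← fderiv_comp u h₂ hd]
    exact h0.fderiv_eq
  have h4 : ∀ w, fderiv ℝ f₁ (c.toFun u) (fderiv ℝ c.toFun u w)
      = fderiv ℝ f₂ (c.toFun u) (fderiv ℝ c.toFun u w) := fun w =>
    congrArg (fun l => l w) h3
  have hdet := chartDet_ne_zero hchar c hu
  constructor
  · have := h4 (coords (c.toFun u) (fderiv ℝ c.toFun u (0, 1)) 2,
        -coords (c.toFun u) (fderiv ℝ c.toFun u (1, 0)) 2)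
    rw [← chartDet_smul_Z hchar c hu, map_smul, map_smul] at this
    exact smul_right_injective _ hdet this
  · have := h4 (-(qbar S.N (c.toFun u) * coords (c.toFun u) (fderiv ℝ c.toFun u (0, 1)) 0
        - pbar S.N (c.toFun u) * coords (c.toFun u) (fderiv ℝ c.toFun u (0, 1)) 1),
        (qbar S.N (c.toFun u) * coords (c.toFun u) (fderiv ℝ c.toFun u (1, 0)) 0
        - pbar S.N (c.toFun u) * coords (c.toFun u) (fderiv ℝ c.toFun u (1, 0)) 1))
    rw [← chartDet_smul_tanT hchar c hu, map_smul, map_smul] at this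
    exact smul_right_injective _ hdet this

/-- The surface need not be closed, but it is relatively closed in a neighbourhood of each of its
points, hence a difference of two open sets. -/
theorem measurableSet_carrier (S : OrientedSurface 3) : MeasurableSet S.carrier := by
  choose! O φ hgO hO using S.exists_defining
  have hU : IsOpen (⋃ g ∈ S.carrier, O g) := isOpen_biUnion fun g hg => (hO g hg).isOpen
  have hV : IsOpen (⋃ g ∈ S.carrier, (O g \ S.carrier)) := by
    refine isOpen_biUnion fun g hg => ?_
    have h1 : O g \ S.carrier = O g ∩ φ g ⁻¹' {0}ᶜ := by
      ext x
      have h2 : x ∈ S.carrier ∩ O g ↔ x ∈ {x ∈ O g | φ g x = 0} := by rw [(hO g hg).inter_eq]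
      simp only [mem_inter_iff, mem_ofPred_eq, Set.mem_sdiff, mem_preimage, mem_compl_iff,
        mem_singleton_iff] at h2 ⊢
      tauto
    rw [h1]
    exact (hO g hg).contDiffOn.continuousOn.isOpen_inter_preimage (hO g hg).isOpen
      isOpen_compl_singleton
  have : S.carrier = (⋃ g ∈ S.carrier, O g) \ ⋃ g ∈ S.carrier, (O g \ S.carrier) := by
    ext x
    simp only [Set.mem_sdiff, mem_iUnion, not_exists, not_and, not_not]
    constructor
    · exact fun hx => ⟨⟨x, hx, hgO x hx⟩, fun _ _ _ => hx⟩
    · rintro ⟨⟨g, hg, hx⟩, h⟩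
      exact h g hg hx
  rw [this]
  exact hU.measurableSet.diff hV.measurableSet

theorem continuousOn_N (S : OrientedSurface 3) : ContinuousOn S.N S.carrier := by
  intro g hg
  obtain ⟨O, hgO, hO⟩ := S.defining_spec hg
  have h1 : ContinuousAt (grad (S.defining g)) g :=
    ((contDiffOn_grad hO.isOpen hO.contDiffOn).contDiffAt
      (hO.isOpen.mem_nhds hgO)).continuousAt
  refine h1.continuousWithinAt.congr_of_eventuallyEq ?_ (hO.normal_eq g ⟨hg, hgO⟩)
  filter_upwards [self_mem_nhdsWithin, mem_nhdsWithin_of_mem_nhds (hO.isOpen.mem_nhds hgO)]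
    with x hx hxO using hO.normal_eq x ⟨hx, hxO⟩

theorem continuousOn_hlen (S : OrientedSurface 3) :
    ContinuousOn (fun g => hlen (S.N g)) S.carrier := by
  have h := continuousOn_pi.1 S.continuousOn_N
  exact (((h 0).pow 2).add ((h 1).pow 2)).sqrt

theorem continuousOn_pbar (hchar : S.charLocus = ∅) : ContinuousOn (pbar S.N) S.carrier :=
  (continuousOn_pi.1 S.continuousOn_N 0).div S.continuousOn_hlen
    fun _ hg => hlen_ne_zero hchar hg

theorem continuousOn_qbar (hchar : S.charLocus = ∅) : ContinuousOn (qbar S.N) S.carrier :=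
  (continuousOn_pi.1 S.continuousOn_N 1).div S.continuousOn_hlen
    fun _ hg => hlen_ne_zero hchar hg

theorem continuousOn_ombar (hchar : S.charLocus = ∅) : ContinuousOn (ombar S.N) S.carrier :=
  (continuousOn_pi.1 S.continuousOn_N 2).div S.continuousOn_hlen
    fun _ hg => hlen_ne_zero hchar hg

theorem continuousOn_Z (hchar : S.charLocus = ∅) : ContinuousOn (Z S.N) S.carrier :=
  ((continuousOn_qbar hchar).smul (contDiff_X₁ (k := 0)).continuous.continuousOn).sub
    ((continuousOn_pbar hchar).smul (contDiff_X₂ (k := 0)).continuous.continuousOn)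

theorem continuousOn_tanT (hchar : S.charLocus = ∅) : ContinuousOn (tanT S.N) S.carrier :=
  (contDiff_T (k := 0)).continuous.continuousOn.sub ((continuousOn_ombar hchar).smul
    (((continuousOn_pbar hchar).smul (contDiff_X₁ (k := 0)).continuous.continuousOn).add
    ((continuousOn_qbar hchar).smul (contDiff_X₂ (k := 0)).continuous.continuousOn)))

end OrientedSurface

/-! ### The `H`-perimeter measure in charts -/

theorem Chart.measurableSet_inter_preimage {M : Set Heis} (c : Chart M) {B : Set Heis}
    (hB : MeasurableSet B) : MeasurableSet (c.dom ∩ c.toFun ⁻¹' B) := by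
  have h1 : Measurable (c.dom.domRestrict c.toFun) :=
    (continuousOn_iff_continuous_domRestrict.1 c.contDiffOn.continuousOn).measurable
  have h2 := c.isOpen_dom.measurableSet.subtype_image (h1 hB)
  convert h2 using 1
  ext u
  simp [Set.domRestrict, and_comm]

theorem Chart.aemeasurable_toFun {M : Set Heis} (c : Chart M) :
    AEMeasurable c.toFun ((volume.restrict c.dom).withDensity fun u =>
      ENNReal.ofReal (hlen (c.normal u) / len (c.normal u) * len (c.normal u))) :=
  (c.contDiffOn.continuousOn.aemeasurable c.isOpen_dom.measurableSet).mono_ac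
    (withDensity_absolutelyContinuous _ _)

theorem Chart.hPerimeter_apply {M : Set Heis} (c : Chart M) {B : Set Heis}
    (hB : MeasurableSet B) :
    c.hPerimeter B = ∫⁻ u in c.dom ∩ c.toFun ⁻¹' B, ENNReal.ofReal (hlen (c.normal u)) := by
  rw [Chart.hPerimeter, Measure.map_apply_of_aemeasurable c.aemeasurable_toFun hB,
    withDensity_apply', Measure.restrict_restrict' c.isOpen_dom.measurableSet, inter_comm]
  simp only [hlen_div_len_mul_len]

theorem det_prod_real (L : ℝ × ℝ →L[ℝ] ℝ × ℝ) :
    L.det = (L (1, 0)).1 * (L (0, 1)).2 - (L (1, 0)).2 * (L (0, 1)).1 := by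
  rw [ContinuousLinearMap.det, ← LinearMap.det_toMatrix (Module.Basis.finTwoProd ℝ),
    Matrix.det_fin_two]
  simp [LinearMap.toMatrix_apply]
  ring

/-- A chart whose inverse extends to a linear map on an open set dominates every other chart
there. -/
theorem Chart.hPerimeter_le_of_patch {M : Set Heis} (c c₀ : Chart M) {O : Set Heis}
    (hO : IsOpen O) {π : Heis →L[ℝ] ℝ × ℝ}
    (hπ : ∀ x ∈ M ∩ O, π x ∈ c₀.dom ∧ c₀.toFun (π x) = x) {B : Set Heis} (hB : MeasurableSet B)
    (hBO : B ⊆ O) : c.hPerimeter B ≤ c₀.hPerimeter B := by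
  rw [c.hPerimeter_apply hB, c₀.hPerimeter_apply hB]
  have hd : ∀ u ∈ c.dom, HasFDerivAt (fun u => π (c.toFun u)) (π.comp (fderiv ℝ c.toFun u)) u :=
    fun u hu => π.hasFDerivAt.comp u
      (OrientedSurface.chart_differentiableAt c hu).hasFDerivAt
  have hnormal : ∀ u ∈ c.dom ∩ c.toFun ⁻¹' B, ENNReal.ofReal (hlen (c.normal u)) =
      ENNReal.ofReal |(π.comp (fderiv ℝ c.toFun u)).det| *
        ENNReal.ofReal (hlen (c₀.normal (π (c.toFun u)))) := by
    rintro u ⟨hu, huB⟩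
    have huO : c.toFun u ∈ M ∩ O := ⟨c.mapsTo hu, hBO huB⟩
    obtain ⟨hd₀, hc₀⟩ := hπ _ huO
    have h1 : HasFDerivAt (fun u => c₀.toFun (π (c.toFun u)))
        ((fderiv ℝ c₀.toFun (π (c.toFun u))).comp (π.comp (fderiv ℝ c.toFun u))) u :=
      (OrientedSurface.chart_differentiableAt c₀ hd₀).hasFDerivAt.comp u (hd u hu)
    have h2 : fderiv ℝ c.toFun u =
        (fderiv ℝ c₀.toFun (π (c.toFun u))).comp (π.comp (fderiv ℝ c.toFun u)) := by
      refine (h1.congr_of_eventuallyEq ?_).fderiv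
      filter_upwards [c.isOpen_dom.mem_nhds hu,
        (OrientedSurface.chart_continuousAt c hu).preimage_mem_nhds (hO.mem_nhds huO.2)]
        with v hv hvO using (hπ _ ⟨c.mapsTo hv, hvO⟩).2.symm
    set τ := π.comp (fderiv ℝ c.toFun u) with hτ
    have h3 : c.normal u = τ.det • c₀.normal (π (c.toFun u)) := by
      have e : ∀ w, τ w = (τ w).1 • ((1, 0) : ℝ × ℝ) + (τ w).2 • ((0, 1) : ℝ × ℝ) := by
        intro w; simp
      have := cross_of_combination
        ((coordsLin (c.toFun u)).comp
          (fderiv ℝ c₀.toFun (π (c.toFun u)) : ℝ × ℝ →ₗ[ℝ] Heis)) (1, 0) (0, 1)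
        (τ (1, 0)).1 (τ (1, 0)).2 (τ (0, 1)).1 (τ (0, 1)).2
      rw [← e, ← e, ← det_prod_real] at this
      simp only [LinearMap.comp_apply, coordsLin_apply, ContinuousLinearMap.coe_coe] at this
      rw [Chart.normal, Chart.normal, hc₀, ← this, h2]
      rfl
    rw [h3, hlen_smul, ENNReal.ofReal_mul (abs_nonneg _)]
  rw [setLIntegral_congr_fun (c.measurableSet_inter_preimage hB) hnormal,
    ← lintegral_image_eq_lintegral_abs_det_fderiv_mul volume (c.measurableSet_inter_preimage hB)
      (fun u hu => (hd u hu.1).hasFDerivWithinAt) ?_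
      (fun v => ENNReal.ofReal (hlen (c₀.normal v)))]
  -- The image of `c` may cover only a part of the patch, hence an inequality.
  · refine lintegral_mono_set ?_
    rintro _ ⟨u, ⟨hu, huB⟩, rfl⟩
    obtain ⟨hd₀, hc₀⟩ := hπ _ ⟨c.mapsTo hu, hBO huB⟩
    refine ⟨hd₀, ?_⟩
    rw [mem_preimage, hc₀]
    exact huB
  · rintro u ⟨hu, huB⟩ v ⟨hv, hvB⟩ huv
    refine c.injOn hu hv ?_
    rw [← (hπ _ ⟨c.mapsTo hu, hBO huB⟩).2, ← (hπ _ ⟨c.mapsTo hv, hBO hvB⟩).2]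
    exact congrArg _ huv

/-- Inside `O` the supremum over all charts is attained by `c₀`, which dominates every other chart
there and has no mass outside `O`. -/
theorem hPerimeter_restrict_patch {M : Set Heis} (c₀ : Chart M) {O : Set Heis}
    (hO : IsOpen O) {π : Heis →L[ℝ] ℝ × ℝ} (hmaps : MapsTo c₀.toFun c₀.dom O)
    (hπ : ∀ x ∈ M ∩ O, π x ∈ c₀.dom ∧ c₀.toFun (π x) = x) :
    (hPerimeter M).restrict O = c₀.hPerimeter := by
  have hc₀ : c₀.hPerimeter.restrict O = c₀.hPerimeter := by
    apply Measure.restrict_eq_self_of_ae_mem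
    rw [ae_iff]
    change c₀.hPerimeter Oᶜ = 0
    rw [c₀.hPerimeter_apply hO.measurableSet.compl]
    have : c₀.dom ∩ c₀.toFun ⁻¹' Oᶜ = ∅ := by
      ext u
      simp only [mem_inter_iff, mem_preimage, mem_compl_iff, mem_empty_iff_false, iff_false,
        not_and, not_not]
      exact fun hu => hmaps hu
    rw [this]; simp
  apply le_antisymm
  · have h1 : hPerimeter M ≤ c₀.hPerimeter + (hPerimeter M).restrict Oᶜ := by
      refine iSup_le fun c => ?_
      rw [← Measure.restrict_add_restrict_compl (μ := c.hPerimeter) hO.measurableSet]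
      refine add_le_add ?_ (Measure.restrict_mono_measure (le_iSup (Chart.hPerimeter (M := M)) c) _)
      rw [← hc₀]
      refine Measure.le_iff.2 fun B hB => ?_
      rw [Measure.restrict_apply hB, Measure.restrict_apply hB]
      exact c.hPerimeter_le_of_patch c₀ hO hπ (hB.inter hO.measurableSet) inter_subset_right
    have h2 := Measure.restrict_mono_measure h1 O
    rw [Measure.restrict_add, hc₀, Measure.restrict_restrict hO.measurableSet] at h2
    simpa using h2
  · rw [← hc₀]
    exact Measure.restrict_mono_measure (le_iSup (Chart.hPerimeter (M := M)) c₀) _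

/-! ### Stokes' theorem -/

theorem contDiff_indicator {E : Type*} [NormedAddCommGroup E] [NormedSpace ℝ E] {f : E → ℝ}
    {U L : Set E} {k : WithTop ℕ∞} (hU : IsOpen U) (hL : IsClosed L) (hLU : L ⊆ U)
    (hf : ContDiffOn ℝ k f U) (h0 : ∀ x ∈ U \ L, f x = 0) : ContDiff ℝ k (U.indicator f) := by
  rw [contDiff_iff_contDiffAt]
  intro x
  by_cases hx : x ∈ U
  · refine (hf.contDiffAt (hU.mem_nhds hx)).congr_of_eventuallyEq ?_
    filter_upwards [hU.mem_nhds hx] with y hy using indicator_of_mem hy f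
  · refine contDiffAt_const (c := 0) |>.congr_of_eventuallyEq ?_
    filter_upwards [hL.isOpen_compl.mem_nhds fun h => hx (hLU h)] with y hy
    by_cases hyU : y ∈ U
    · rw [indicator_of_mem hyU, h0 y ⟨hyU, hy⟩]
    · exact indicator_of_notMem hyU f

theorem integral_fderiv_eq_zero_of_hasCompactSupport {f : ℝ × ℝ → ℝ} (hf : ContDiff ℝ 1 f)
    (hc : HasCompactSupport f) (v : ℝ × ℝ) : ∫ u, fderiv ℝ f u v = 0 := by
  have h := integral_mul_fderiv_eq_neg_fderiv_mul_of_integrable (μ := (volume : Measure (ℝ × ℝ)))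
    (f := fun _ => (1 : ℝ)) (g := f) (v := v) (by simp) ?_ ?_
    (fun _ _ => differentiableAt_const _) (fun u _ => hf.differentiable (by norm_num) u)
  · simpa using h
  · simp only [one_mul]
    refine ((hf.continuous_fderiv (by norm_num)).clm_apply
      continuous_const).integrable_of_hasCompactSupport ?_
    exact hc.fderiv_apply (𝕜 := ℝ) v
  · simpa using hf.continuous.integrable_of_hasCompactSupport hc

/-- Stokes' theorem for the form `f dk` in the plane. -/
theorem setIntegral_jacobian_eq_zero {f k : ℝ × ℝ → ℝ} {U L : Set (ℝ × ℝ)} (hU : IsOpen U)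
    (hL : IsCompact L) (hLU : L ⊆ U) (hf : ContDiffOn ℝ 1 f U) (h0 : ∀ x ∈ U \ L, f x = 0)
    (hk : ContDiffOn ℝ 2 k U) :
    ∫ u in U, (fderiv ℝ f u (1, 0) * fderiv ℝ k u (0, 1)
      - fderiv ℝ f u (0, 1) * fderiv ℝ k u (1, 0)) = 0 := by
  have hk1 : ContDiffOn ℝ 1 (fderiv ℝ k) U := hk.fderiv_of_isOpen hU (by norm_num)
  have hP : ∀ v : ℝ × ℝ, ContDiffOn ℝ 1 (fun u => f u * fderiv ℝ k u v) U := fun v =>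
    hf.mul (hk1.clm_apply contDiffOn_const)
  have hP0 : ∀ v : ℝ × ℝ, ∀ u ∈ U \ L, f u * fderiv ℝ k u v = 0 := fun v u hu => by
    rw [h0 u hu, zero_mul]
  have hcs : ∀ v : ℝ × ℝ, HasCompactSupport (U.indicator fun u => f u * fderiv ℝ k u v) := by
    refine fun v => HasCompactSupport.intro hL fun u hu => ?_
    by_cases huU : u ∈ U
    · rw [indicator_of_mem huU, hP0 v u ⟨huU, hu⟩]
    · exact indicator_of_notMem huU _
  have hcd := fun v => contDiff_indicator hU hL.isClosed hLU (hP v) (hP0 v)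
  have hint : ∀ v w : ℝ × ℝ,
      Integrable fun u => fderiv ℝ (U.indicator fun u => f u * fderiv ℝ k u v) u w := fun v w =>
    (((hcd v).continuous_fderiv (by norm_num)).clm_apply
      continuous_const).integrable_of_hasCompactSupport ((hcs v).fderiv_apply (𝕜 := ℝ) w)
  have hout : ∀ v w : ℝ × ℝ, ∀ u ∉ U,
      fderiv ℝ (U.indicator fun u => f u * fderiv ℝ k u v) u w = 0 := by
    intro v w u hu
    have : (U.indicator fun u => f u * fderiv ℝ k u v) =ᶠ[𝓝 u] fun _ => 0 := by
      filter_upwards [hL.isClosed.isOpen_compl.mem_nhds fun h => hu (hLU h)] with y hy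
      by_cases hyU : y ∈ U
      · rw [indicator_of_mem hyU, hP0 v y ⟨hyU, hy⟩]
      · exact indicator_of_notMem hyU _
    rw [this.fderiv_eq]; simp
  have hin : ∀ v w : ℝ × ℝ, ∀ u ∈ U,
      fderiv ℝ (U.indicator fun u => f u * fderiv ℝ k u v) u w
        = fderiv ℝ f u w * fderiv ℝ k u v + f u * fderiv ℝ (fderiv ℝ k) u w v := by
    intro v w u hu
    have h1 : (U.indicator fun u => f u * fderiv ℝ k u v) =ᶠ[𝓝 u]
        fun u => f u * fderiv ℝ k u v := by
      filter_upwards [hU.mem_nhds hu] with y hy using indicator_of_mem hy _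
    have hfd := ((hf.contDiffAt (hU.mem_nhds hu)).differentiableAt (by norm_num)).hasFDerivAt
    have hkd := ((hk1.contDiffAt (hU.mem_nhds hu)).differentiableAt (by norm_num)).hasFDerivAt
    have h2 := hfd.mul (hkd.clm_apply (hasFDerivAt_const v u))
    rw [h1.fderiv_eq, HasFDerivAt.fderiv (f := fun u => f u * fderiv ℝ k u v) h2]
    simp
    ring
  have hsymm : ∀ u ∈ U, fderiv ℝ (fderiv ℝ k) u (1, 0) (0, 1)
      = fderiv ℝ (fderiv ℝ k) u (0, 1) (1, 0) := by
    intro u hu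
    have := (hk.contDiffAt (hU.mem_nhds hu)).isSymmSndFDerivAt (by simp)
    exact this (1, 0) (0, 1)
  -- This is `df ∧ dk = d(f dk)`: the second derivatives of `k` cancel by symmetry. So `k` has to be
  -- `C²`, while `C¹` suffices for `f`.
  have h1 : ∫ u in U, (fderiv ℝ f u (1, 0) * fderiv ℝ k u (0, 1)
      - fderiv ℝ f u (0, 1) * fderiv ℝ k u (1, 0)) =
      ∫ u in U, (fderiv ℝ (U.indicator fun u => f u * fderiv ℝ k u (0, 1)) u (1, 0)
        - fderiv ℝ (U.indicator fun u => f u * fderiv ℝ k u (1, 0)) u (0, 1)) := by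
    refine setIntegral_congr_fun hU.measurableSet fun u hu => ?_
    rw [hin _ _ u hu, hin _ _ u hu, hsymm u hu]
    ring
  rw [h1, setIntegral_eq_integral_of_forall_compl_eq_zero
    (fun u hu => by rw [hout _ _ u hu, hout _ _ u hu, sub_zero]),
    integral_sub (hint _ _) (hint _ _),
    integral_fderiv_eq_zero_of_hasCompactSupport (hcd _) (hcs _),
    integral_fderiv_eq_zero_of_hasCompactSupport (hcd _) (hcs _), sub_zero]

/-! ### Stokes' theorem on the surface -/

namespace OrientedSurface

variable {S : OrientedSurface 3}

/-- The value of the form `dA ∧ dl` on `(Z, T - ω̄ Y)`, for a linear function `l`. -/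
noncomputable def bracket (S : OrientedSurface 3) (A : Heis → ℝ) (l : Heis →L[ℝ] ℝ) (g : Heis) :
    ℝ :=
  fderiv ℝ A g (Z S.N g) * l (tanT S.N g) - fderiv ℝ A g (tanT S.N g) * l (Z S.N g)

theorem continuousOn_bracket (hchar : S.charLocus = ∅) {A : Heis → ℝ} (hA : ContDiff ℝ 1 A)
    (l : Heis →L[ℝ] ℝ) : ContinuousOn (bracket S A l) S.carrier := by
  have h1 := (hA.continuous_fderiv (by norm_num)).continuousOn (s := S.carrier)
  exact ((h1.clm_apply (continuousOn_Z hchar)).mul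
    (l.continuous.comp_continuousOn (continuousOn_tanT hchar))).sub
    ((h1.clm_apply (continuousOn_tanT hchar)).mul
    (l.continuous.comp_continuousOn (continuousOn_Z hchar)))

/-- Off `S` the function `A` is arbitrary, so only its tangential derivatives vanish; as `K` is
closed, `A` is zero on a whole neighbourhood in `S`. -/
theorem fderiv_eq_zero_of_notMem (hchar : S.charLocus = ∅) {K : Set Heis} (hK : IsClosed K)
    {A : Heis → ℝ} (hA : ContDiff ℝ 1 A) (h0 : ∀ g ∈ S.carrier \ K, A g = 0) {g : Heis}
    (hg : g ∈ S.carrier \ K) :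
    fderiv ℝ A g (Z S.N g) = 0 ∧ fderiv ℝ A g (tanT S.N g) = 0 := by
  have := fderiv_eq_of_eqOn hchar (f₂ := fun _ => 0) hg.1 (hK.isOpen_compl.mem_nhds hg.2)
    (hA.differentiable (by norm_num) g) (differentiableAt_const _) h0
  simpa using this

theorem bracket_eq_zero_of_notMem (hchar : S.charLocus = ∅) {K : Set Heis} (hK : IsClosed K)
    {A : Heis → ℝ} (hA : ContDiff ℝ 1 A) (h0 : ∀ g ∈ S.carrier \ K, A g = 0)
    (l : Heis →L[ℝ] ℝ) {g : Heis} (hg : g ∈ S.carrier \ K) : bracket S A l g = 0 := by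
  obtain ⟨h1, h2⟩ := fderiv_eq_zero_of_notMem hchar hK hA h0 hg
  rw [bracket, h1, h2]; ring

theorem integrableOn_of_continuousOn {K : Set Heis} (hK : IsCompact K)
    (hfin : hPerimeter S.carrier K < ⊤) {F : Heis → ℝ} (hF : ContinuousOn F K)
    (h0 : ∀ g ∈ S.carrier \ K, F g = 0) : IntegrableOn F S.carrier (hPerimeter S.carrier) := by
  obtain ⟨C, hC⟩ := hK.exists_bound_of_continuousOn hF
  have h1 : IntegrableOn F K (hPerimeter S.carrier) :=
    IntegrableOn.of_bound hfin (hF.aestronglyMeasurable hK.measurableSet) C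
      ((ae_restrict_iff' hK.measurableSet).2 (Eventually.of_forall hC))
  exact h1.of_forall_sdiff_eq_zero S.measurableSet_carrier h0

theorem continuousOn_fderiv_chart {M : Set Heis} (c : Chart M) (w : ℝ × ℝ) :
    ContinuousOn (fun u => fderiv ℝ c.toFun u w) c.dom :=
  (c.contDiffOn.continuousOn_fderiv_of_isOpen c.isOpen_dom (by norm_num)).clm_apply
    continuousOn_const

theorem continuousOn_coords_chart {M : Set Heis} (c : Chart M) (w : ℝ × ℝ) (i : Fin 3) :
    ContinuousOn (fun u => coords (c.toFun u) (fderiv ℝ c.toFun u w) i) c.dom := by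
  have h1 := continuousOn_fderiv_chart c w
  have h2 := c.contDiffOn.continuousOn
  have h3 : Continuous fun q : Heis × Heis => coords q.1 q.2 i := by
    fin_cases i <;> simp [coords] <;> fun_prop
  exact h3.comp_continuousOn (h2.prodMk h1)

theorem continuousOn_chartDet (hchar : S.charLocus = ∅) (c : Chart S.carrier) :
    ContinuousOn (chartDet S c) c.dom := by
  have hp := (continuousOn_pbar hchar).comp c.contDiffOn.continuousOn c.mapsTo
  have hq := (continuousOn_qbar hchar).comp c.contDiffOn.continuousOn c.mapsTo
  exact (((hq.mul (continuousOn_coords_chart c _ 0)).sub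
    (hp.mul (continuousOn_coords_chart c _ 1))).mul (continuousOn_coords_chart c _ 2)).sub
    ((continuousOn_coords_chart c _ 2).mul ((hq.mul (continuousOn_coords_chart c _ 0)).sub
    (hp.mul (continuousOn_coords_chart c _ 1))))

/-- A continuous function without zeros keeps its sign on a connected domain. The sign may differ
between charts, which is harmless because Stokes' theorem gives zero in each of them. -/
theorem exists_sign_chartDet (hchar : S.charLocus = ∅) (c : Chart S.carrier)
    (hc : IsPreconnected c.dom) : ∃ ε : ℝ, ∀ u ∈ c.dom, |chartDet S c u| = ε * chartDet S c u := by
  have h := hc.eq_or_eq_neg_of_sq_eq (continuousOn_chartDet hchar c).abs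
    (continuousOn_chartDet hchar c) (fun u _ => by simp)
    (fun hu => chartDet_ne_zero hchar c hu)
  rcases h with h | h
  · exact ⟨1, fun u hu => by rw [one_mul]; exact h hu⟩
  · exact ⟨-1, fun u hu => by rw [neg_one_mul]; exact h hu⟩

theorem setIntegral_chart (hchar : S.charLocus = ∅) (c : Chart S.carrier) {F : Heis → ℝ}
    (hF : ContinuousOn F S.carrier) :
    ∫ g in S.carrier, F g ∂c.hPerimeter = ∫ u in c.dom, |chartDet S c u| * F (c.toFun u) := by
  have hm := c.isOpen_dom.measurableSet
  rw [← integral_indicator S.measurableSet_carrier, Chart.hPerimeter,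
    integral_map c.aemeasurable_toFun
      ((aestronglyMeasurable_indicator_iff S.measurableSet_carrier).2
        (hF.aestronglyMeasurable S.measurableSet_carrier))]
  have h1 : ((volume.restrict c.dom).withDensity fun u =>
      ENNReal.ofReal (hlen (c.normal u) / len (c.normal u) * len (c.normal u)))
      = (volume.restrict c.dom).withDensity fun u => ENNReal.ofReal |chartDet S c u| := by
    apply withDensity_congr_ae
    filter_upwards [ae_restrict_mem hm] with u hu
    rw [hlen_div_len_mul_len, hlen_normal_chart hchar c hu]
  rw [h1, integral_withDensity_eq_integral_toReal_smul₀
    (((continuousOn_chartDet hchar c).abs.aemeasurable hm).ennreal_ofReal)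
    (Eventually.of_forall fun _ => ENNReal.ofReal_lt_top)]
  refine setIntegral_congr_fun hm fun u hu => ?_
  simp only [smul_eq_mul]
  rw [indicator_of_mem (c.mapsTo hu), ENNReal.toReal_ofReal (abs_nonneg _)]

/-- In the chart, `σ_H` has density `|chartDet|`, and `chartDet` times the bracket is the Jacobian
of the pulled-back pair `(A, l)`. Up to the constant sign the integral is therefore the planar one.
The chart must be `C²` for the pullback of `l` to be so. -/
theorem integral_bracket_eq_zero_of_patch (hchar : S.charLocus = ∅) {c : Chart S.carrier}
    {O K : Set Heis} {π : Heis →L[ℝ] ℝ × ℝ} (hO : IsOpen O) (hconn : IsPreconnected c.dom)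
    (hc2 : ContDiffOn ℝ 2 c.toFun c.dom) (hmaps : MapsTo c.toFun c.dom O)
    (hleft : ∀ u ∈ c.dom, π (c.toFun u) = u)
    (hπ : ∀ x ∈ S.carrier ∩ O, π x ∈ c.dom ∧ c.toFun (π x) = x)
    (hK : IsCompact K) (hKS : K ⊆ S.carrier ∩ O) {A : Heis → ℝ} (hA : ContDiff ℝ 1 A)
    (h0 : ∀ g ∈ S.carrier \ K, A g = 0) (l : Heis →L[ℝ] ℝ) :
    ∫ g in S.carrier, bracket S A l g ∂(hPerimeter S.carrier) = 0 := by
  have h1 : ∫ g in S.carrier, bracket S A l g ∂(hPerimeter S.carrier)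
      = ∫ g in S.carrier ∩ O, bracket S A l g ∂(hPerimeter S.carrier) := by
    refine setIntegral_eq_of_subset_of_forall_sdiff_eq_zero S.measurableSet_carrier
      inter_subset_left fun g hg => ?_
    exact bracket_eq_zero_of_notMem hchar hK.isClosed hA h0 l
      ⟨hg.1, fun hgK => hg.2 (hKS hgK)⟩
  rw [h1, ← Measure.restrict_restrict S.measurableSet_carrier,
    hPerimeter_restrict_patch c hO hmaps hπ, setIntegral_chart hchar c
      (continuousOn_bracket hchar hA l)]
  obtain ⟨ε, hε⟩ := exists_sign_chartDet hchar c hconn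
  have h2 : ∫ u in c.dom, |chartDet S c u| * bracket S A l (c.toFun u) =
      ∫ u in c.dom, ε * (fderiv ℝ (fun u => A (c.toFun u)) u (1, 0)
          * fderiv ℝ (fun u => l (c.toFun u)) u (0, 1)
        - fderiv ℝ (fun u => A (c.toFun u)) u (0, 1)
          * fderiv ℝ (fun u => l (c.toFun u)) u (1, 0)) := by
    refine setIntegral_congr_fun c.isOpen_dom.measurableSet fun u hu => ?_
    have hd := (chart_differentiableAt c hu).hasFDerivAt
    have e1 : fderiv ℝ (fun u => A (c.toFun u)) u
        = (fderiv ℝ A (c.toFun u)).comp (fderiv ℝ c.toFun u) :=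
      ((hA.differentiable (by norm_num) _).hasFDerivAt.comp u hd).fderiv
    have e2 : fderiv ℝ (fun u => l (c.toFun u)) u = l.comp (fderiv ℝ c.toFun u) :=
      (l.hasFDerivAt.comp u hd).fderiv
    simp only [e1, e2, ContinuousLinearMap.comp_apply]
    rw [chart_bracket hchar c hu, hε u hu, bracket]
    ring
  rw [h2, integral_const_mul]
  rw [setIntegral_jacobian_eq_zero (f := fun u => A (c.toFun u)) (k := fun u => l (c.toFun u))
    c.isOpen_dom (hK.image π.continuous) ?_
    (hA.comp_contDiffOn c.contDiffOn) ?_ (l.contDiff.comp_contDiffOn hc2), mul_zero]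
  · rintro _ ⟨x, hx, rfl⟩
    exact (hπ x (hKS hx)).1
  · rintro u ⟨hu, huK⟩
    refine h0 _ ⟨c.mapsTo hu, fun h => huK ⟨_, h, hleft u hu⟩⟩

/-- Stokes' theorem for the form `A dl` on the surface. -/
theorem integral_bracket_eq_zero (hchar : S.charLocus = ∅) {K : Set Heis} (hK : IsCompact K)
    (hKS : K ⊆ S.carrier) (hfin : hPerimeter S.carrier K < ⊤) {A : Heis → ℝ}
    (hA : ContDiff ℝ 1 A) (h0 : ∀ g ∈ S.carrier \ K, A g = 0) (l : Heis →L[ℝ] ℝ) :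
    ∫ g in S.carrier, bracket S A l g ∂(hPerimeter S.carrier) = 0 := by
  choose! O c π hO hgO hconn hc2 hmaps hleft hπ using
    fun (g : Heis) (hg : g ∈ S.carrier) => exists_patch hchar hg
  obtain ⟨t, htK, ht⟩ := hK.elim_nhds_subcover O
    fun g hg => (hO g (hKS hg)).mem_nhds (hgO g (hKS hg))
  obtain ⟨f, hf⟩ := SmoothPartitionOfUnity.exists_isSubordinate 𝓘(ℝ, Heis) hK.isClosed
    (fun i : t => O i) (fun i => hO i (hKS (htK i i.2)))
    (by simpa [iUnion_subtype] using ht)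
  have hfc : ∀ i, ContDiff ℝ 1 (fun g => f i g * A g) := fun i =>
    (((f i).contMDiff.contDiff).of_le (by exact_mod_cast le_top)).mul hA
  have hsum : ∀ g ∈ S.carrier, A g = ∑ i, f i g * A g := by
    intro g hg
    by_cases hgK : g ∈ K
    · have := f.sum_eq_one hgK
      rw [finsum_eq_sum_of_fintype] at this
      rw [← Finset.sum_mul, this, one_mul]
    · simp [h0 g ⟨hg, hgK⟩]
  have hz : ∀ i, ∀ g ∈ S.carrier \ (K ∩ tsupport (f i)), f i g * A g = 0 := by
    rintro i g ⟨hg, hgn⟩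
    by_cases hgK : g ∈ K
    · rw [image_eq_zero_of_notMem_tsupport fun h => hgn ⟨hgK, h⟩, zero_mul]
    · rw [h0 g ⟨hg, hgK⟩, mul_zero]
  -- The decomposition of `A` holds only on `S`, which is enough since the bracket contains
  -- tangential derivatives alone.
  have hb : ∀ g ∈ S.carrier, bracket S A l g = ∑ i, bracket S (fun g => f i g * A g) l g := by
    intro g hg
    have hs : ContDiff ℝ 1 fun g => ∑ i, f i g * A g := ContDiff.sum fun i _ => hfc i
    obtain ⟨e1, e2⟩ := fderiv_eq_of_eqOn hchar hg univ_mem (hA.differentiable (by norm_num) g)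
      (hs.differentiable (by norm_num) g) (fun x hx => hsum x hx.1)
    have e3 : fderiv ℝ (fun g => ∑ i, f i g * A g) g = ∑ i, fderiv ℝ (fun g => f i g * A g) g :=
      fderiv_fun_sum fun i _ => (hfc i).differentiable (by norm_num) g
    rw [bracket, e1, e2, e3]
    simp only [bracket, sum_apply, Finset.sum_mul, Finset.sum_sub_distrib]
  rw [setIntegral_congr_fun S.measurableSet_carrier hb, integral_finsetSum]
  · refine Finset.sum_eq_zero fun i _ => ?_
    have hi := hKS (htK i i.2)
    exact integral_bracket_eq_zero_of_patch hchar (hO i hi) (hconn i hi) (hc2 i hi) (hmaps i hi)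
      (hleft i hi) (hπ i hi) (hK.inter_right (isClosed_tsupport _))
      (fun x hx => ⟨hKS hx.1, hf i hx.2⟩) (hfc i) (hz i) l
  · intro i _
    refine integrableOn_of_continuousOn hK hfin
      ((continuousOn_bracket hchar (hfc i) l).mono hKS) fun g hg => ?_
    exact bracket_eq_zero_of_notMem hchar hK.isClosed (hfc i)
      (fun x hx => by rw [h0 x hx, mul_zero]) l hg

end OrientedSurface

/-! ### Diffeomorphisms and the `H`-perimeter measure -/

/-- Small compactly supported displacements are diffeomorphisms. -/
theorem eventually_exists_diffeo {E : Type*} [NormedAddCommGroup E] [NormedSpace ℝ E]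
    [FiniteDimensional ℝ E] [Nontrivial E] {η : E → E} (hη : ContDiff ℝ 1 η)
    (hc : HasCompactSupport η) :
    ∀ᶠ s in 𝓝 (0 : ℝ), ∃ e : E ≃ₜ E, (∀ g, e g = g + s • η g) ∧ ContDiff ℝ 1 e ∧
      ContDiff ℝ 1 e.symm := by
  have : CompleteSpace E := FiniteDimensional.complete ℝ E
  obtain ⟨L, hL⟩ := hη.lipschitzWith_of_hasCompactSupport hc (by norm_num)
  have hsmall : ∀ᶠ s in 𝓝 (0 : ℝ), ‖s‖₊ * L < 1 := by
    have : Tendsto (fun s : ℝ => ‖s‖₊ * L) (𝓝 0) (𝓝 (‖(0 : ℝ)‖₊ * L)) :=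
      (continuous_nnnorm.mul continuous_const).tendsto 0
    rw [nnnorm_zero, zero_mul] at this
    exact this.eventually_lt_const one_pos
  filter_upwards [hsmall] with s hs
  have hd : ContDiff ℝ 1 fun g => g + s • η g := contDiff_id.add (hη.const_smul s)
  have hlip : LipschitzWith (‖s‖₊ * L) fun g => s • η g := by
    refine LipschitzWith.of_dist_le_mul fun x y => ?_
    rw [dist_eq_norm, ← smul_sub, norm_smul, NNReal.coe_mul, mul_assoc, coe_nnnorm]
    exact mul_le_mul_of_nonneg_left (by simpa [dist_eq_norm] using hL.dist_le_mul x y)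
      (norm_nonneg s)
  have happ : ApproximatesLinearOn (fun g => g + s • η g)
      ((ContinuousLinearEquiv.refl ℝ E : E ≃L[ℝ] E) : E →L[ℝ] E) univ (‖s‖₊ * L) := by
    rw [ApproximatesLinearOn.approximatesLinearOn_iff_lipschitzOnWith]
    refine (LipschitzWith.lipschitzOnWith ?_)
    convert hlip using 1
    ext g; simp
  have hN : Subsingleton E ∨ ‖s‖₊ * L <
      ‖((ContinuousLinearEquiv.refl ℝ E).symm : E →L[ℝ] E)‖₊⁻¹ := by
    right
    have : ‖((ContinuousLinearEquiv.refl ℝ E).symm : E →L[ℝ] E)‖₊ = 1 := by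
      rw [ContinuousLinearEquiv.refl_symm, ContinuousLinearEquiv.coe_refl]
      exact nnnorm_one (G := E →L[ℝ] E)
    rw [this, inv_one]; exact hs
  -- A kernel vector satisfies `v = -D(sη) v`, and `D(sη)` has norm below 1. The inverse is then
  -- `C¹` by the inverse function theorem.
  have hinj : ∀ g, Function.Injective (fderiv ℝ (fun g => g + s • η g) g : E →ₗ[ℝ] E) := by
    intro g
    rw [injective_iff_map_eq_zero]
    intro v hv
    have h1 : fderiv ℝ (fun g => g + s • η g) g = ContinuousLinearMap.id ℝ E
        + fderiv ℝ (fun g => s • η g) g := by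
      have h2 : DifferentiableAt ℝ (fun g => s • η g) g :=
        (hη.const_smul s).differentiable (by norm_num) g
      exact ((hasFDerivAt_id g).add h2.hasFDerivAt).fderiv
    have h3 : v = -fderiv ℝ (fun g => s • η g) g v := by
      have h4 : v + fderiv ℝ (fun g => s • η g) g v = 0 := by simpa [h1] using hv
      exact eq_neg_of_add_eq_zero_left h4
    have h5 : ‖v‖ ≤ (‖s‖₊ * L : NNReal) * ‖v‖ := by
      conv_lhs => rw [h3, norm_neg]
      exact ((fderiv ℝ (fun g => s • η g) g).le_opNorm v).trans
        (mul_le_mul_of_nonneg_right (norm_fderiv_le_of_lipschitz ℝ hlip) (norm_nonneg v))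
    have h6 : ((‖s‖₊ * L : NNReal) : ℝ) < 1 := by exact_mod_cast hs
    by_contra hne
    have := norm_pos_iff.2 hne
    nlinarith
  refine ⟨happ.toHomeomorph _ hN, fun g => rfl, hd, ?_⟩
  refine Homeomorph.contDiff_symm (f₀' := fun g =>
    (LinearEquiv.ofInjectiveEndo _ (hinj g)).toContinuousLinearEquiv) _ (fun g => ?_) hd
  have : (((LinearEquiv.ofInjectiveEndo _ (hinj g)).toContinuousLinearEquiv : E ≃L[ℝ] E) :
      E →L[ℝ] E) = fderiv ℝ (fun g => g + s • η g) g := ContinuousLinearMap.ext fun _ => rfl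
  rw [this]
  exact (hd.differentiable (by norm_num) g).hasFDerivAt

/-- The image of a chart under a diffeomorphism. -/
def Chart.push {M M' : Set Heis} (c : Chart M) (e : Heis ≃ₜ Heis) (he : ContDiff ℝ 1 e)
    (he' : ContDiff ℝ 1 e.symm) (hM : MapsTo e M M') : Chart M' where
  dom := c.dom
  toFun := fun u => e (c.toFun u)
  isOpen_dom := c.isOpen_dom
  contDiffOn := he.comp_contDiffOn c.contDiffOn
  injOn := fun _ hu _ hv h => c.injOn hu hv (e.injective h)
  immersion := by
    intro u hu
    have hc := (OrientedSurface.chart_differentiableAt c hu).hasFDerivAt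
    have hed := (he.differentiable (by norm_num) (c.toFun u)).hasFDerivAt
    have h1 : fderiv ℝ (fun u => e (c.toFun u)) u
        = (fderiv ℝ e (c.toFun u)).comp (fderiv ℝ c.toFun u) := (hed.comp u hc).fderiv
    have h2 := ((he'.differentiable (by norm_num) (e (c.toFun u))).hasFDerivAt.comp
      (c.toFun u) hed)
    have h3 : e.symm ∘ e = id := by ext1 x; simp
    rw [h3] at h2
    have h4 := h2.unique (hasFDerivAt_id _)
    rw [h1, ContinuousLinearMap.coe_comp]
    refine Function.Injective.comp (Function.LeftInverse.injective
      (g := fderiv ℝ e.symm (e (c.toFun u))) fun w => ?_) (c.immersion u hu)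
    exact DFunLike.congr_fun h4 w
  mapsTo := fun _ hu => hM (c.mapsTo hu)

theorem Chart.setLIntegral_hPerimeter {M : Set Heis} (c : Chart M) {B : Set Heis}
    (hB : MeasurableSet B) {f : Heis → ℝ≥0∞} (hf : Measurable f) :
    ∫⁻ x in B, f x ∂c.hPerimeter
      = ∫⁻ u in c.dom ∩ c.toFun ⁻¹' B, f (c.toFun u) * ENNReal.ofReal (hlen (c.normal u)) := by
  have hm := c.isOpen_dom.measurableSet
  have hcn : ContinuousOn (fun u => hlen (c.normal u)) c.dom := by
    have h0 := fun w i => OrientedSurface.continuousOn_coords_chart c w i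
    have h1 : ∀ i, ContinuousOn (fun u => c.normal u i) c.dom := by
      intro i
      fin_cases i
      all_goals
        simp only [Chart.normal, cross_apply, Fin.reduceFinMk, Matrix.cons_val_zero,
          Matrix.cons_val_one, Matrix.cons_val, Fin.zero_eta, Fin.mk_one, Fin.isValue]
        exact ((h0 _ _).mul (h0 _ _)).sub ((h0 _ _).mul (h0 _ _))
    exact (((h1 0).pow 2).add ((h1 1).pow 2)).sqrt
  rw [← lintegral_indicator hB, Chart.hPerimeter,
    lintegral_map' (hf.indicator hB).aemeasurable c.aemeasurable_toFun]
  simp only [hlen_div_len_mul_len]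
  rw [lintegral_withDensity_eq_lintegral_mul₀ (g := fun u => B.indicator f (c.toFun u)) (hcn.aemeasurable hm).ennreal_ofReal
    ((hf.indicator hB).comp_aemeasurable (c.contDiffOn.continuousOn.aemeasurable hm)),
    ← inter_comm, ← Measure.restrict_restrict' hm,
    ← lintegral_indicator₀ ((c.contDiffOn.continuousOn.aemeasurable hm).nullMeasurable hB)]
  refine lintegral_congr fun u => ?_
  by_cases hu : c.toFun u ∈ B
  · rw [indicator_of_mem (show u ∈ c.toFun ⁻¹' B from hu), Pi.mul_apply, indicator_of_mem hu,
      mul_comm]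
  · rw [indicator_of_notMem (show u ∉ c.toFun ⁻¹' B from hu), Pi.mul_apply,
      indicator_of_notMem hu, mul_zero]

theorem withDensity_mono_left {α : Type*} [MeasurableSpace α] {μ ν : Measure α} (h : μ ≤ ν)
    (f : α → ℝ≥0∞) : μ.withDensity f ≤ ν.withDensity f := by
  refine Measure.le_iff.2 fun s hs => ?_
  rw [withDensity_apply _ hs, withDensity_apply _ hs]
  exact lintegral_mono' (Measure.restrict_mono_measure h s) le_rfl

/-- The transformation of the `H`-perimeter measure under a diffeomorphism with Jacobian `J`. -/
theorem hPerimeter_image {M : Set Heis} (e : Heis ≃ₜ Heis) (he : ContDiff ℝ 1 e)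
    (he' : ContDiff ℝ 1 e.symm) {J : Heis → ℝ≥0∞} (hJ : Measurable J) (hJ0 : ∀ g, J g ≠ 0)
    (hJt : ∀ g, J g ≠ ⊤)
    (h : ∀ c : Chart M, ∀ u ∈ c.dom,
      ENNReal.ofReal (hlen ((c.push e he he' (mapsTo_image e M)).normal u))
        = J (c.toFun u) * ENNReal.ofReal (hlen (c.normal u)))
    {B : Set Heis} (hB : MeasurableSet B) :
    hPerimeter (e '' M) (e '' B) = ∫⁻ g in B, J g ∂(hPerimeter M) := by
  have hpush : ∀ c : Chart M, (c.push e he he' (mapsTo_image e M)).hPerimeter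
      = (c.hPerimeter.withDensity J).map e := by
    intro c
    ext B' hB'
    rw [Chart.hPerimeter_apply _ hB', Measure.map_apply e.continuous.measurable hB',
      withDensity_apply _ (e.continuous.measurable hB'),
      c.setLIntegral_hPerimeter (e.continuous.measurable hB') hJ]
    exact setLIntegral_congr_fun (c.measurableSet_inter_preimage (e.continuous.measurable hB'))
      fun u hu => h c u hu.1
  have hsymm : MapsTo e.symm (e '' M) M := by
    rintro _ ⟨x, hx, rfl⟩
    simpa using hx
  have hle : hPerimeter (e '' M) ≤ ((hPerimeter M).withDensity J).map e := by
    refine iSup_le fun c' => ?_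
    -- Every chart of the image is the transport of a chart of `M`, so the bound passes to the
    -- supremum.
    have hc' : (c'.push e.symm he' he hsymm).push e he he' (mapsTo_image e M) = c' := by
      cases c'
      simp [Chart.push]
    rw [← hc', hpush]
    exact Measure.map_mono (withDensity_mono_left
      (le_iSup (Chart.hPerimeter (M := M)) _) J) e.continuous.measurable
  -- Densities and suprema of measures need not be interchanged: the bound is proved for `hPerimeter
  -- M` with the inverse density on the other side, where it can be checked chart by chart, and then
  -- multiplied by `J`.
  have hge : (hPerimeter M).withDensity J ≤ (hPerimeter (e '' M)).map e.symm := by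
    set ν := (hPerimeter (e '' M)).map e.symm
    have h1 : hPerimeter M ≤ ν.withDensity fun g => (J g)⁻¹ := by
      refine iSup_le fun c => ?_
      rw [← withDensity_inv_same (μ := c.hPerimeter) hJ (Eventually.of_forall hJ0)
        (Eventually.of_forall hJt)]
      refine withDensity_mono_left ?_ _
      have h2 : c.hPerimeter.withDensity J
          = (c.push e he he' (mapsTo_image e M)).hPerimeter.map e.symm := by
        rw [hpush, Measure.map_map e.symm.continuous.measurable e.continuous.measurable]
        simp
      rw [h2]
      exact Measure.map_mono (le_iSup (Chart.hPerimeter (M := e '' M)) _)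
        e.symm.continuous.measurable
    refine (withDensity_mono_left h1 J).trans (le_of_eq ?_)
    have h3 := withDensity_inv_same (μ := ν) (f := fun g => (J g)⁻¹) hJ.inv
      (Eventually.of_forall fun g => ENNReal.inv_ne_zero.2 (hJt g))
      (Eventually.of_forall fun g => ENNReal.inv_ne_top.2 (hJ0 g))
    simpa only [inv_inv] using h3
  have hBe : MeasurableSet (e '' B) := e.measurableEmbedding.measurableSet_image.2 hB
  rw [← withDensity_apply _ hB]
  apply le_antisymm
  · refine (hle _).trans (le_of_eq ?_)
    rw [Measure.map_apply e.continuous.measurable hBe, e.preimage_image]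
  · refine (hge _).trans (le_of_eq ?_)
    rw [Measure.map_apply e.symm.continuous.measurable hB,
      ← e.image_eq_preimage_symm B]

/-! ### The Jacobian of the deformation -/

/-- The horizontal field `a X₁ + b X₂`. -/
noncomputable def hfield (a b : Heis → ℝ) (g : Heis) : Heis := a g • X₁ g + b g • X₂ g

theorem contDiff_hfield {a b : Heis → ℝ} {k : WithTop ℕ∞} (ha : ContDiff ℝ k a)
    (hb : ContDiff ℝ k b) : ContDiff ℝ k (hfield a b) :=
  (ha.smul contDiff_X₁).add (hb.smul contDiff_X₂)

theorem hasCompactSupport_hfield {a b : Heis → ℝ} (ha : HasCompactSupport a)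
    (hb : HasCompactSupport b) : HasCompactSupport (hfield a b) :=
  ha.smul_right.add hb.smul_right

/-- The components are taken in the frame at the moved point, so the third one is the pullback of
the contact form `dt + (y dx - x dy) / 2`. It is quadratic in `s` and the other two are affine, so
the horizontal part of a vector product is cubic. -/
theorem hasFDerivAt_displacement {a b : Heis → ℝ} {g : Heis} (ha : DifferentiableAt ℝ a g)
    (hb : DifferentiableAt ℝ b g) (s : ℝ) :
    ∃ D : Heis →L[ℝ] Heis, HasFDerivAt (fun x => x + s • hfield a b x) D g ∧
      ∀ v, coords (g + s • hfield a b g) (D v) =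
        ![v.1 + s * fderiv ℝ a g v, v.2.1 + s * fderiv ℝ b g v,
          coords g v 2 + s * (b g * v.1 - a g * v.2.1)
            + s ^ 2 / 2 * (b g * fderiv ℝ a g v - a g * fderiv ℝ b g v)] := by
  let dx : Heis →L[ℝ] ℝ := ContinuousLinearMap.fst ℝ ℝ (ℝ × ℝ)
  let dy : Heis →L[ℝ] ℝ :=
    (ContinuousLinearMap.fst ℝ ℝ ℝ).comp (ContinuousLinearMap.snd ℝ ℝ (ℝ × ℝ))
  let dt : Heis →L[ℝ] ℝ :=
    (ContinuousLinearMap.snd ℝ ℝ ℝ).comp (ContinuousLinearMap.snd ℝ ℝ (ℝ × ℝ))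
  have hx : HasFDerivAt (fun x : Heis => x.1) dx g := dx.hasFDerivAt
  have hy : HasFDerivAt (fun x : Heis => x.2.1) dy g := dy.hasFDerivAt
  have ht : HasFDerivAt (fun x : Heis => x.2.2) dt g := dt.hasFDerivAt
  have h1 := hx.add (ha.hasFDerivAt.const_mul s)
  have h2 := hy.add (hb.hasFDerivAt.const_mul s)
  have h3 := ht.add (((hx.mul hb.hasFDerivAt).sub (hy.mul ha.hasFDerivAt)).const_mul (s / 2))
  have h4 := h1.prodMk (h2.prodMk h3)
  refine ⟨_, h4.congr_of_eventuallyEq (Eventually.of_forall fun x => ?_), fun v => ?_⟩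
  · ext <;> simp [hfield, X₁, X₂]
    ring
  · ext i
    fin_cases i
    · simp [coords, dx, dy, dt]
    · simp [coords, dx, dy, dt]
    · simp [coords, hfield, X₁, X₂, dx, dy, dt]; ring

/-- The cubic polynomial with coefficients `x`. -/
def cubic (x : Fin 4 → ℝ) (s : ℝ) : ℝ := x 0 + x 1 * s + x 2 * s ^ 2 + x 3 * s ^ 3

namespace OrientedSurface

variable {S : OrientedSurface 3}

/-- The coefficients of the `X₁`-component of the normal of the deformed surface. -/
noncomputable def normalCoeff₁ (S : OrientedSurface 3) (a b h : Heis → ℝ) (g : Heis) :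
    Fin 4 → ℝ :=
  let p := pbar S.N g
  let q := qbar S.N g
  let w := ombar S.N g
  let aZ := fderiv ℝ a g (Z S.N g)
  let aT := fderiv ℝ a g (tanT S.N g)
  let bZ := fderiv ℝ b g (Z S.N g)
  let bT := fderiv ℝ b g (tanT S.N g)
  let kZ := b g * aZ - a g * bZ
  let kT := b g * aT - a g * bT
  ![-p, bZ + h g * w * q, -p * kT / 2 - h g * bT + kZ * w * q / 2, (bZ * kT - kZ * bT) / 2]

/-- The coefficients of the `X₂`-component of the normal of the deformed surface. -/
noncomputable def normalCoeff₂ (S : OrientedSurface 3) (a b h : Heis → ℝ) (g : Heis) :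
    Fin 4 → ℝ :=
  let p := pbar S.N g
  let q := qbar S.N g
  let w := ombar S.N g
  let aZ := fderiv ℝ a g (Z S.N g)
  let aT := fderiv ℝ a g (tanT S.N g)
  let bZ := fderiv ℝ b g (Z S.N g)
  let bT := fderiv ℝ b g (tanT S.N g)
  let kZ := b g * aZ - a g * bZ
  let kT := b g * aT - a g * bT
  ![-q, -(h g * w * p) - aZ, -q * kT / 2 + h g * aT - kZ * w * p / 2, (kZ * aT - aZ * kT) / 2]

/-- The Jacobian of the deformation `g ↦ g + s (a X₁ + b X₂)` for the `H`-perimeter measure. -/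
noncomputable def jac (S : OrientedSurface 3) (a b h : Heis → ℝ) (s : ℝ) (g : Heis) : ℝ :=
  √(cubic (normalCoeff₁ S a b h g) s ^ 2 + cubic (normalCoeff₂ S a b h g) s ^ 2)

/-- The cubics of `jac` are the horizontal components of the product of the images of `Z` and `T -
ω̄ Y`. They simplify because `b dx - a dy` is `h (p̄² + q̄²) = h` on `Z` and zero on `T - ω̄ Y`. -/
theorem hlen_normal_push (hchar : S.charLocus = ∅) {a b h : Heis → ℝ} (ha : ContDiff ℝ 1 a)
    (hb : ContDiff ℝ 1 b) (ha' : ∀ g ∈ S.carrier, a g = h g * pbar S.N g)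
    (hb' : ∀ g ∈ S.carrier, b g = h g * qbar S.N g) {s : ℝ} {e : Heis ≃ₜ Heis}
    (hes : ∀ g, e g = g + s • hfield a b g) (he : ContDiff ℝ 1 e) (he' : ContDiff ℝ 1 e.symm)
    {M' : Set Heis} (hM : MapsTo e S.carrier M') (c : Chart S.carrier) {u : ℝ × ℝ}
    (hu : u ∈ c.dom) :
    hlen ((c.push e he he' hM).normal u) = jac S a b h s (c.toFun u) * hlen (c.normal u) := by
  have hg := c.mapsTo hu
  obtain ⟨D, hD, hDc⟩ := hasFDerivAt_displacement (g := c.toFun u)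
    (ha.differentiable (by norm_num) _) (hb.differentiable (by norm_num) _) s
  have hfd : fderiv ℝ (c.push e he he' hM).toFun u = D.comp (fderiv ℝ c.toFun u) := by
    refine HasFDerivAt.fderiv ?_
    have h1 : (c.push e he he' hM).toFun = fun v => c.toFun v + s • hfield a b (c.toFun v) :=
      funext fun v => hes _
    rw [h1]
    exact hD.comp u (chart_differentiableAt c hu).hasFDerivAt
  have hpt : (c.push e he he' hM).toFun u = c.toFun u + s • hfield a b (c.toFun u) := hes _
  have hcross := cross_fderiv_chart hchar c hu
    ((coordsLin (c.toFun u + s • hfield a b (c.toFun u))).comp (D : Heis →ₗ[ℝ] Heis))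
  simp only [LinearMap.comp_apply, coordsLin_apply, ContinuousLinearMap.coe_coe] at hcross
  rw [hlen_normal_chart hchar c hu, Chart.normal, hpt, hfd]
  simp only [ContinuousLinearMap.comp_apply]
  rw [hcross, hlen_smul, mul_comm]
  congr 1
  have hpq := pbar_sq_add_qbar_sq (hlen_ne_zero hchar hg)
  have e1 := ha' _ hg
  have e2 := hb' _ hg
  have e3 : coords (c.toFun u) (Z S.N (c.toFun u)) 2 = 0 := by rw [coords_Z]; rfl
  have e4 : coords (c.toFun u) (tanT S.N (c.toFun u)) 2 = 1 := by rw [coords_tanT]; rfl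
  rw [hDc, hDc, e3, e4, hlen, jac]
  simp only [Z_fst, Z_snd_fst, tanT_fst, tanT_snd_fst]
  congr 2
  · congr 1
    simp only [cross_apply, cubic, normalCoeff₁, Matrix.cons_val_zero, Matrix.cons_val_one,
      Matrix.cons_val]
    generalize fderiv ℝ a (c.toFun u) (Z S.N (c.toFun u)) = aZ
    generalize fderiv ℝ a (c.toFun u) (tanT S.N (c.toFun u)) = aT
    generalize fderiv ℝ b (c.toFun u) (Z S.N (c.toFun u)) = bZ
    generalize fderiv ℝ b (c.toFun u) (tanT S.N (c.toFun u)) = bT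
    rw [e1, e2]
    generalize pbar S.N (c.toFun u) = p at *
    generalize qbar S.N (c.toFun u) = q at *
    generalize ombar S.N (c.toFun u) = w at *
    generalize h (c.toFun u) = η at *
    linear_combination (s * η) * (w * q - s * bT) * hpq
  · congr 1
    simp only [cross_apply, cubic, normalCoeff₂, Matrix.cons_val_zero, Matrix.cons_val_one,
      Matrix.cons_val]
    generalize fderiv ℝ a (c.toFun u) (Z S.N (c.toFun u)) = aZ
    generalize fderiv ℝ a (c.toFun u) (tanT S.N (c.toFun u)) = aT
    generalize fderiv ℝ b (c.toFun u) (Z S.N (c.toFun u)) = bZ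
    generalize fderiv ℝ b (c.toFun u) (tanT S.N (c.toFun u)) = bT
    rw [e1, e2]
    generalize pbar S.N (c.toFun u) = p at *
    generalize qbar S.N (c.toFun u) = q at *
    generalize ombar S.N (c.toFun u) = w at *
    generalize h (c.toFun u) = η at *
    linear_combination (s * η) * (-(w * p) + s * aT) * hpq

/-! ### Extension of the deformation field to the whole space -/

theorem defining_regular (hchar : S.charLocus = ∅) {g : Heis} (hg : g ∈ S.carrier) :
    ∃ O ∈ 𝓝 g, (∀ x ∈ S.carrier ∩ O, S.N x = S.normalNear g x) ∧
      ∀ x ∈ O, ContDiffAt ℝ 2 (S.normalNear g) x ∧ hlen (S.normalNear g x) ≠ 0 := by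
  obtain ⟨O, hgO, hO⟩ := S.defining_spec hg
  have hcd := contDiffOn_grad hO.isOpen hO.contDiffOn
  have hW : hlen (S.normalNear g g) ≠ 0 := by
    rw [normalNear, ← hO.normal_eq g ⟨hg, hgO⟩]
    exact hlen_ne_zero hchar hg
  have hc : ContinuousAt (fun x => hlen (S.normalNear g x)) g :=
    (contDiffAt_hlen (hcd.contDiffAt (hO.isOpen.mem_nhds hgO)) hW).continuousAt
  refine ⟨O ∩ {x | hlen (S.normalNear g x) ≠ 0},
    inter_mem (hO.isOpen.mem_nhds hgO) (hc.eventually_ne hW),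
    fun x hx => hO.normal_eq x ⟨hx.1, hx.2.1⟩,
    fun x hx => ⟨hcd.contDiffAt (hO.isOpen.mem_nhds hx.1), hx.2⟩⟩

/-- A function on the surface with compact support that has local `C²` extensions has a global
one with compact support. -/
theorem exists_extension {K : Set Heis} (hK : IsCompact K) {F : Heis → ℝ}
    (h0 : ∀ g ∈ S.carrier \ K, F g = 0)
    (hloc : ∀ g ∈ K, ∃ O ∈ 𝓝 g, ∃ f : Heis → ℝ, ContDiffOn ℝ 2 f O ∧
      ∀ x ∈ S.carrier ∩ O, f x = F x) :
    ∃ f : Heis → ℝ, ContDiff ℝ 2 f ∧ HasCompactSupport f ∧ ∀ g ∈ S.carrier, f g = F g := by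
  -- The admissible values form a single point on `S` and the whole line elsewhere. These sets are
  -- convex, so local solutions can be glued.
  obtain ⟨f, hf⟩ := exists_contMDiffMap_forall_mem_convex_of_local (n := 2) 𝓘(ℝ, Heis)
    (t := fun g => {y : ℝ | g ∈ S.carrier → y = F g}) (by
      intro g
      by_cases hg : g ∈ S.carrier
      · simp [hg]
      · simp [hg, convex_univ]) (by
      intro g
      by_cases hg : g ∈ K
      · obtain ⟨O, hO, f, hf, hfF⟩ := hloc g hg
        exact ⟨O, hO, f, hf.contMDiffOn, fun x hx hxS => hfF x ⟨hxS, hx⟩⟩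
      · exact ⟨Kᶜ, hK.isClosed.isOpen_compl.mem_nhds hg, fun _ => 0, contMDiffOn_const,
          fun x hx hxS => (h0 x ⟨hxS, hx⟩).symm⟩)
  obtain ⟨K', hK', hKK'⟩ := exists_compact_superset hK
  obtain ⟨χ, hχ1, hχ0, -⟩ := exists_contMDiffMap_one_nhds_of_subset_interior (n := 2)
    𝓘(ℝ, Heis) hK.isClosed hKK'
  refine ⟨fun g => χ g * f g, χ.contMDiff.contDiff.mul f.contMDiff.contDiff, ?_, fun g hg => ?_⟩
  · exact HasCompactSupport.intro hK' fun g hg => by rw [hχ0 g hg, zero_mul]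
  · have hfg : f g = F g := hf g hg
    simp only [hfg]
    by_cases hgK : g ∈ K
    · rw [hχ1.self_of_nhdsSet g hgK, one_mul]
    · rw [h0 g ⟨hg, hgK⟩, mul_zero]

theorem exists_field_extension (hchar : S.charLocus = ∅) {h : Heis → ℝ} (hh : ContDiff ℝ 2 h)
    {K : Set Heis} (hK : IsCompact K) (hKS : K ⊆ S.carrier)
    (hsupp : ∀ g ∈ S.carrier \ K, h g = 0) :
    ∃ a b : Heis → ℝ, ContDiff ℝ 2 a ∧ ContDiff ℝ 2 b ∧ HasCompactSupport a ∧
      HasCompactSupport b ∧ (∀ g ∈ S.carrier, a g = h g * pbar S.N g) ∧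
      ∀ g ∈ S.carrier, b g = h g * qbar S.N g := by
  obtain ⟨a, ha, hac, haS⟩ := exists_extension hK (F := fun g => h g * pbar S.N g)
    (fun g hg => by rw [hsupp g hg, zero_mul]) (fun g hg => by
      obtain ⟨O, hO, h1, h2⟩ := defining_regular hchar (hKS hg)
      refine ⟨O, hO, fun x => h x * pbar (S.normalNear g) x, fun x hx => ?_, fun x hx => ?_⟩
      · exact (hh.contDiffAt.mul (contDiffAt_pbar (h2 x hx).1 (h2 x hx).2)).contDiffWithinAt
      · rw [pbar_congr (h1 x hx)])
  obtain ⟨b, hb, hbc, hbS⟩ := exists_extension hK (F := fun g => h g * qbar S.N g)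
    (fun g hg => by rw [hsupp g hg, zero_mul]) (fun g hg => by
      obtain ⟨O, hO, h1, h2⟩ := defining_regular hchar (hKS hg)
      refine ⟨O, hO, fun x => h x * qbar (S.normalNear g) x, fun x hx => ?_, fun x hx => ?_⟩
      · exact (hh.contDiffAt.mul (contDiffAt_qbar (h2 x hx).1 (h2 x hx).2)).contDiffWithinAt
      · rw [qbar_congr (h1 x hx)])
  exact ⟨a, b, ha, hb, hac, hbc, haS, hbS⟩

end OrientedSurface

/-! ### Differentiation under the integral sign -/

theorem HasSecondDerivAt.const_add_congr {V V₁ : ℝ → ℝ} {d x : ℝ} (r : ℝ)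
    (h : HasSecondDerivAt V d x) (heq : ∀ᶠ s in 𝓝 x, V₁ s = r + V s) :
    HasSecondDerivAt V₁ d x := by
  obtain ⟨V', h1, h2⟩ := h
  refine ⟨V', ?_, h2⟩
  filter_upwards [h1, heq.eventually_nhds] with s hs1 hs2
  exact (hs1.const_add r).congr_of_eventuallyEq hs2

/-- The integrand depends on the point only through the parameters `θ g`, which range over a compact
set. Joint continuity in `s` and the parameters then gives a constant dominating function. -/
theorem hasDerivAt_setIntegral_of_compact {α P : Type*} [TopologicalSpace α] [MeasurableSpace α]
    [OpensMeasurableSpace α] [T2Space α] [TopologicalSpace P] {μ : Measure α}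
    {K : Set α} (hK : IsCompact K) (hfin : μ K < ⊤) {θ : α → P} (hθ : ContinuousOn θ K)
    {Φ Φ₁ : ℝ × P → ℝ} {ε : ℝ} (h0 : ContinuousOn Φ (Icc (-ε) ε ×ˢ (θ '' K)))
    (h1 : ContinuousOn Φ₁ (Icc (-ε) ε ×ˢ (θ '' K)))
    (hd : ∀ s ∈ Icc (-ε) ε, ∀ p ∈ θ '' K, HasDerivAt (fun s => Φ (s, p)) (Φ₁ (s, p)) s)
    {s₀ : ℝ} (hs₀ : s₀ ∈ Ioo (-ε) ε) :
    HasDerivAt (fun s => ∫ g in K, Φ (s, θ g) ∂μ) (∫ g in K, Φ₁ (s₀, θ g) ∂μ) s₀ := by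
  have hKm := hK.measurableSet
  have hcont : ∀ {Ψ : ℝ × P → ℝ}, ContinuousOn Ψ (Icc (-ε) ε ×ˢ (θ '' K)) →
      ∀ s ∈ Icc (-ε) ε, ContinuousOn (fun g => Ψ (s, θ g)) K := fun hΨ s hs =>
    hΨ.comp (continuousOn_const.prodMk hθ) fun g hg => ⟨hs, mem_image_of_mem θ hg⟩
  have hsub := Ioo_subset_Icc_self (a := -ε) (b := ε)
  obtain ⟨C₀, hC₀⟩ := (isCompact_Icc.prod (hK.image_of_continuousOn hθ)).exists_bound_of_continuousOn
    h0
  obtain ⟨C, hC⟩ := (isCompact_Icc.prod (hK.image_of_continuousOn hθ)).exists_bound_of_continuousOn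
    h1
  have hsm : ∀ {Ψ : ℝ × P → ℝ}, ContinuousOn Ψ (Icc (-ε) ε ×ˢ (θ '' K)) →
      ∀ s ∈ Icc (-ε) ε, AEStronglyMeasurable (fun g => Ψ (s, θ g)) (μ.restrict K) :=
    fun hΨ s hs => (hcont hΨ s hs).aestronglyMeasurable_of_isCompact hK hKm
  have hint : IntegrableOn (fun g => Φ (s₀, θ g)) K μ :=
    IntegrableOn.of_bound hfin (hsm h0 s₀ (hsub hs₀)) C₀
      ((ae_restrict_iff' hKm).2 (Eventually.of_forall fun g hg =>
        hC₀ _ ⟨hsub hs₀, mem_image_of_mem θ hg⟩))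
  refine (hasDerivAt_integral_of_dominated_loc_of_deriv_le (F := fun s g => Φ (s, θ g))
    (F' := fun s g => Φ₁ (s, θ g)) (s := Ioo (-ε) ε) (bound := fun _ => C)
    (isOpen_Ioo.mem_nhds hs₀) ?_ hint (hsm h1 s₀ (hsub hs₀)) ?_
    (integrableOn_const hfin.ne) ?_).2
  · filter_upwards [isOpen_Ioo.mem_nhds hs₀] with s hs using hsm h0 s (hsub hs)
  · exact (ae_restrict_iff' hKm).2 (Eventually.of_forall fun g hg s hs =>
      hC _ ⟨hsub hs, mem_image_of_mem θ hg⟩)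
  · exact (ae_restrict_iff' hKm).2 (Eventually.of_forall fun g hg s hs =>
      hd s (hsub hs) _ (mem_image_of_mem θ hg))

/-- Twofold differentiation under the integral sign over a compact set. -/
theorem hasSecondDerivAt_setIntegral_of_compact {α P : Type*} [TopologicalSpace α]
    [MeasurableSpace α] [OpensMeasurableSpace α] [T2Space α] [TopologicalSpace P] {μ : Measure α}
    {K : Set α} (hK : IsCompact K) (hfin : μ K < ⊤) {θ : α → P} (hθ : ContinuousOn θ K)
    {Φ Φ₁ Φ₂ : ℝ × P → ℝ} {ε : ℝ} (hε : 0 < ε)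
    (h0 : ContinuousOn Φ (Icc (-ε) ε ×ˢ (θ '' K)))
    (h1 : ContinuousOn Φ₁ (Icc (-ε) ε ×ˢ (θ '' K)))
    (h2 : ContinuousOn Φ₂ (Icc (-ε) ε ×ˢ (θ '' K)))
    (hd : ∀ s ∈ Icc (-ε) ε, ∀ p ∈ θ '' K, HasDerivAt (fun s => Φ (s, p)) (Φ₁ (s, p)) s)
    (hd₁ : ∀ s ∈ Icc (-ε) ε, ∀ p ∈ θ '' K, HasDerivAt (fun s => Φ₁ (s, p)) (Φ₂ (s, p)) s) :
    HasSecondDerivAt (fun s => ∫ g in K, Φ (s, θ g) ∂μ) (∫ g in K, Φ₂ (0, θ g) ∂μ) 0 := by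
  have h00 : (0 : ℝ) ∈ Ioo (-ε) ε := ⟨by linarith, hε⟩
  refine ⟨fun s => ∫ g in K, Φ₁ (s, θ g) ∂μ, ?_,
    hasDerivAt_setIntegral_of_compact hK hfin hθ h1 h2 hd₁ h00⟩
  filter_upwards [isOpen_Ioo.mem_nhds h00] with s hs
  exact hasDerivAt_setIntegral_of_compact hK hfin hθ h0 h1 hd hs

theorem hasDerivAt_cubic (x : Fin 4 → ℝ) (s : ℝ) :
    HasDerivAt (cubic x) (x 1 + 2 * x 2 * s + 3 * x 3 * s ^ 2) s := by
  have h := (((hasDerivAt_id s).const_mul (x 1)).const_add (x 0)).add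
    (((hasDerivAt_pow 2 s).const_mul (x 2)))
  have h' := h.add ((hasDerivAt_pow 3 s).const_mul (x 3))
  refine h'.congr_deriv ?_
  norm_num; ring

theorem hasDerivAt_cubic_deriv (x : Fin 4 → ℝ) (s : ℝ) :
    HasDerivAt (fun s => x 1 + 2 * x 2 * s + 3 * x 3 * s ^ 2) (2 * x 2 + 6 * x 3 * s) s := by
  have h := (((hasDerivAt_id s).const_mul (2 * x 2)).const_add (x 1)).add
    (((hasDerivAt_pow 2 s).const_mul (3 * x 3)))
  refine h.congr_deriv ?_
  norm_num; ring

/-- The squared length of a pair of cubic polynomials. -/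
def normSq (z : ℝ × (Fin 4 → ℝ) × (Fin 4 → ℝ)) : ℝ := cubic z.2.1 z.1 ^ 2 + cubic z.2.2 z.1 ^ 2

/-- The derivative of `normSq` with respect to the variable of the polynomials. -/
def normSqDeriv (z : ℝ × (Fin 4 → ℝ) × (Fin 4 → ℝ)) : ℝ :=
  2 * cubic z.2.1 z.1 * (z.2.1 1 + 2 * z.2.1 2 * z.1 + 3 * z.2.1 3 * z.1 ^ 2)
    + 2 * cubic z.2.2 z.1 * (z.2.2 1 + 2 * z.2.2 2 * z.1 + 3 * z.2.2 3 * z.1 ^ 2)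

/-- The second derivative of `normSq` with respect to the variable of the polynomials. -/
def normSqDeriv₂ (z : ℝ × (Fin 4 → ℝ) × (Fin 4 → ℝ)) : ℝ :=
  2 * (z.2.1 1 + 2 * z.2.1 2 * z.1 + 3 * z.2.1 3 * z.1 ^ 2) ^ 2
    + 2 * cubic z.2.1 z.1 * (2 * z.2.1 2 + 6 * z.2.1 3 * z.1)
    + 2 * (z.2.2 1 + 2 * z.2.2 2 * z.1 + 3 * z.2.2 3 * z.1 ^ 2) ^ 2
    + 2 * cubic z.2.2 z.1 * (2 * z.2.2 2 + 6 * z.2.2 3 * z.1)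

theorem continuous_normSq : Continuous normSq := by
  unfold normSq cubic; fun_prop
theorem continuous_normSqDeriv : Continuous normSqDeriv := by
  unfold normSqDeriv cubic; fun_prop
theorem continuous_normSqDeriv₂ : Continuous normSqDeriv₂ := by
  unfold normSqDeriv₂ cubic; fun_prop

theorem hasDerivAt_normSq (p : (Fin 4 → ℝ) × (Fin 4 → ℝ)) (s : ℝ) :
    HasDerivAt (fun s => normSq (s, p)) (normSqDeriv (s, p)) s := by
  refine (((hasDerivAt_cubic p.1 s).pow 2).add ((hasDerivAt_cubic p.2 s).pow 2)).congr_deriv ?_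
  simp [normSqDeriv]

theorem hasDerivAt_normSqDeriv (p : (Fin 4 → ℝ) × (Fin 4 → ℝ)) (s : ℝ) :
    HasDerivAt (fun s => normSqDeriv (s, p)) (normSqDeriv₂ (s, p)) s := by
  refine ((((hasDerivAt_cubic p.1 s).const_mul 2).mul (hasDerivAt_cubic_deriv p.1 s)).add
    (((hasDerivAt_cubic p.2 s).const_mul 2).mul (hasDerivAt_cubic_deriv p.2 s))).congr_deriv ?_
  simp only [normSqDeriv₂]
  ring

/-- The first and second variation of the integral of the length of a pair of cubic polynomials
that has length one at the origin. -/
theorem hasSecondDerivAt_integral_sqrt_normSq {μ : Measure Heis} {K : Set Heis}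
    (hK : IsCompact K) (hfin : μ K < ⊤) {x y : Heis → Fin 4 → ℝ} (hx : ContinuousOn x K)
    (hy : ContinuousOn y K) (h1 : ∀ g ∈ K, x g 0 ^ 2 + y g 0 ^ 2 = 1) :
    (∀ᶠ s in 𝓝 (0 : ℝ), ∀ g ∈ K, 0 < normSq (s, x g, y g)) ∧
    HasSecondDerivAt (fun s => ∫ g in K, √(normSq (s, x g, y g)) ∂μ)
      (∫ g in K, (x g 1 ^ 2 + y g 1 ^ 2 + 2 * (x g 0 * x g 2 + y g 0 * y g 2)
        - (x g 0 * x g 1 + y g 0 * y g 1) ^ 2) ∂μ) 0 := by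
  set θ : Heis → (Fin 4 → ℝ) × (Fin 4 → ℝ) := fun g => (x g, y g) with hθdef
  have hθ : ContinuousOn θ K := hx.prodMk hy
  -- Compactness gives one interval of `s` for all points of `K`, on which the square root is
  -- smooth.
  have hpos : ∀ᶠ s in 𝓝 (0 : ℝ), ∀ p ∈ θ '' K, 0 < normSq (s, p) := by
    refine (hK.image_of_continuousOn hθ).eventually_forall_of_forall_eventually ?_
    rintro _ ⟨g, hg, rfl⟩
    have h3 : 0 < normSq (0, θ g) := by
      have : normSq (0, θ g) = 1 := by rw [← h1 g hg]; simp [normSq, cubic, hθdef]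
      rw [this]; exact one_pos
    exact continuous_normSq.continuousAt.eventually_const_lt h3
  refine ⟨hpos.mono fun s hs g hg => hs _ (mem_image_of_mem θ hg), ?_⟩
  obtain ⟨r, hr, hball⟩ := Metric.eventually_nhds_iff_ball.1 hpos
  have hε : 0 < r / 2 := by linarith
  have hp : ∀ s ∈ Icc (-(r / 2)) (r / 2), ∀ p ∈ θ '' K, 0 < normSq (s, p) := by
    intro s hs
    refine hball s ?_
    rw [mem_ball_zero_iff, Real.norm_eq_abs]
    have := abs_le.2 hs
    linarith
  have hsq : ContinuousOn (fun z => √(normSq z)) (Icc (-(r / 2)) (r / 2) ×ˢ (θ '' K)) :=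
    (Real.continuous_sqrt.comp continuous_normSq).continuousOn
  have hne : ∀ z ∈ Icc (-(r / 2)) (r / 2) ×ˢ (θ '' K), √(normSq z) ≠ 0 := fun z hz =>
    (Real.sqrt_pos.2 (hp z.1 hz.1 z.2 hz.2)).ne'
  have key := hasSecondDerivAt_setIntegral_of_compact (μ := μ) hK hfin hθ hε
    (Φ := fun z => √(normSq z)) (Φ₁ := fun z => normSqDeriv z / (2 * √(normSq z)))
    (Φ₂ := fun z => normSqDeriv₂ z / (2 * √(normSq z))
      - normSqDeriv z ^ 2 / (4 * normSq z * √(normSq z))) hsq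
    (continuous_normSqDeriv.continuousOn.div (continuousOn_const.mul hsq)
      fun z hz => mul_ne_zero two_ne_zero (hne z hz))
    ((continuous_normSqDeriv₂.continuousOn.div (continuousOn_const.mul hsq)
      fun z hz => mul_ne_zero two_ne_zero (hne z hz)).sub
      ((continuous_normSqDeriv.continuousOn.pow 2).div
        ((continuousOn_const.mul continuous_normSq.continuousOn).mul hsq)
        fun z hz => mul_ne_zero (mul_ne_zero four_ne_zero (hp z.1 hz.1 z.2 hz.2).ne') (hne z hz)))
    (fun s hs p hpK => (hasDerivAt_normSq p s).sqrt (hp s hs p hpK).ne')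
    (fun s hs p hpK => by
      have hsp := hp s hs p hpK
      have hs0 := hne (s, p) ⟨hs, hpK⟩
      refine ((hasDerivAt_normSqDeriv p s).div
        (((hasDerivAt_normSq p s).sqrt hsp.ne').const_mul 2)
        (mul_ne_zero two_ne_zero hs0)).congr_deriv ?_
      have hss : √(normSq (s, p)) ^ 2 = normSq (s, p) := Real.sq_sqrt hsp.le
      -- In terms of `t = √(normSq (s, p))` the identity becomes rational.
      rw [← hss]
      rw [Real.sqrt_sq (Real.sqrt_nonneg _)]
      generalize √(normSq (s, p)) = t at *
      field_simp
      ring)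
  -- Where `normSq` equals 1, the second derivative of its root is half its second derivative minus
  -- a quarter of the square of its first.
  refine (congrArg (HasSecondDerivAt _ · 0) ?_).mp key
  refine setIntegral_congr_fun hK.measurableSet fun g hg => ?_
  have h3 : normSq (0, θ g) = 1 := by rw [← h1 g hg]; simp [normSq, cubic, hθdef]
  simp only [h3, Real.sqrt_one]
  simp [normSqDeriv, normSqDeriv₂, cubic, hθdef]
  ring

/-! ### The second variation of the density -/

namespace OrientedSurface

variable {S : OrientedSurface 3}

variable {a b h : Heis → ℝ}

/-- The pointwise relation between the second derivative of the Jacobian and the integrand of the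
second variation. -/
theorem second_variation_pointwise (hchar : S.charLocus = ∅) (ha : ContDiff ℝ 1 a)
    (hb : ContDiff ℝ 1 b) (hh : ContDiff ℝ 1 h) (ha' : ∀ g ∈ S.carrier, a g = h g * pbar S.N g)
    (hb' : ∀ g ∈ S.carrier, b g = h g * qbar S.N g) {g : Heis} (hg : g ∈ S.carrier) :
    S.integrand h g =
      normalCoeff₁ S a b h g 1 ^ 2 + normalCoeff₂ S a b h g 1 ^ 2
        + 2 * (normalCoeff₁ S a b h g 0 * normalCoeff₁ S a b h g 2
          + normalCoeff₂ S a b h g 0 * normalCoeff₂ S a b h g 2)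
        - (normalCoeff₁ S a b h g 0 * normalCoeff₁ S a b h g 1
          + normalCoeff₂ S a b h g 0 * normalCoeff₂ S a b h g 1) ^ 2
      + (bracket S (fun x => h x * a x) (ContinuousLinearMap.fst ℝ ℝ (ℝ × ℝ)) g
        + bracket S (fun x => h x * b x)
          ((ContinuousLinearMap.fst ℝ ℝ ℝ).comp (ContinuousLinearMap.snd ℝ ℝ (ℝ × ℝ))) g) := by
  obtain ⟨O, hO, hN, hreg⟩ := defining_regular hchar hg
  have hgO := mem_of_mem_nhds hO
  obtain ⟨hcd, hW⟩ := hreg g hgO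
  set n := S.normalNear g with hn
  have hNg : S.N g = n g := hN g ⟨hg, hgO⟩
  have hpd : DifferentiableAt ℝ (pbar n) g :=
    (contDiffAt_pbar hcd hW).differentiableAt (by norm_num)
  have hqd : DifferentiableAt ℝ (qbar n) g :=
    (contDiffAt_qbar hcd hW).differentiableAt (by norm_num)
  have had := ha.differentiable (by norm_num) g
  have hbd := hb.differentiable (by norm_num) g
  have hhd := hh.differentiable (by norm_num) g
  have ep : pbar n g = pbar S.N g := pbar_congr hNg.symm
  have eq : qbar n g = qbar S.N g := qbar_congr hNg.symm
  have ew : ombar n g = ombar S.N g := ombar_congr hNg.symm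
  have eY : Y n g = Y S.N g := Y_congr hNg.symm
  -- Although `a` is an arbitrary extension, its tangential derivatives are those of `h p̄` for the
  -- local defining function.
  obtain ⟨haZ, haT⟩ := fderiv_eq_of_eqOn hchar hg hO had (hhd.mul hpd) fun x hx => by
    rw [ha' x hx.1, Pi.mul_apply, pbar_congr (hN x hx)]
  obtain ⟨hbZ, hbT⟩ := fderiv_eq_of_eqOn hchar hg hO hbd (hhd.mul hqd) fun x hx => by
    rw [hb' x hx.1, Pi.mul_apply, qbar_congr (hN x hx)]
  have hunit : ∀ v, pbar n g * fderiv ℝ (pbar n) g v + qbar n g * fderiv ℝ (qbar n) g v = 0 := by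
    intro v
    have h1 : (fun x => pbar n x * pbar n x + qbar n x * qbar n x) =ᶠ[𝓝 g] fun _ => 1 := by
      filter_upwards [hO] with x hx
      rw [← sq, ← sq]
      exact pbar_sq_add_qbar_sq (hreg x hx).2
    have h2 := ((hpd.hasFDerivAt.mul hpd.hasFDerivAt).add
      (hqd.hasFDerivAt.mul hqd.hasFDerivAt)).unique
      ((hasFDerivAt_const (1 : ℝ) g).congr_of_eventuallyEq h1)
    have h3 := DFunLike.congr_fun h2 v
    simp at h3
    linarith
  have hpZ := hunit (Z S.N g)
  have hpT := hunit (tanT S.N g)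
  -- The derivatives along `T` and `Y` combine to the tangential derivative along `T - ω̄ Y`.
  have htwist : twistT n g + ombar n g * twistY n g
      = pbar n g * fderiv ℝ (qbar n) g (tanT S.N g)
        - qbar n g * fderiv ℝ (pbar n) g (tanT S.N g) := by
    simp only [twistT, twistY, along, tanT, map_sub, map_smul, smul_eq_mul, eY, ew]
    ring
  have hpq := pbar_sq_add_qbar_sq (hlen_ne_zero hchar hg)
  have hha : fderiv ℝ (fun x => h x * a x) g = h g • fderiv ℝ a g + a g • fderiv ℝ h g :=
    (hhd.hasFDerivAt.mul had.hasFDerivAt).fderiv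
  have hhb : fderiv ℝ (fun x => h x * b x) g = h g • fderiv ℝ b g + b g • fderiv ℝ h g :=
    (hhd.hasFDerivAt.mul hbd.hasFDerivAt).fderiv
  rw [(hhd.hasFDerivAt.mul hpd.hasFDerivAt).fderiv] at haZ haT
  rw [(hhd.hasFDerivAt.mul hqd.hasFDerivAt).fderiv] at hbZ hbT
  have hA : 2 * S.calA g - ombar S.N g ^ 2 = 2 * (twistT n g + ombar n g * twistY n g)
      + ombar S.N g ^ 2 := by
    rw [OrientedSurface.calA, Heis.calA, ← hn, ew]; ring
  rw [integrand, hA, htwist, along]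
  simp only [bracket, hha, hhb, normalCoeff₁, normalCoeff₂, Matrix.cons_val_zero,
    Matrix.cons_val_one, Matrix.cons_val, add_apply,
    smul_apply, smul_eq_mul, ContinuousLinearMap.coe_fst',
    ContinuousLinearMap.comp_apply, ContinuousLinearMap.coe_snd', Z_fst, Z_snd_fst,
    tanT_fst, tanT_snd_fst] at haZ haT hbZ hbT ⊢
  rw [ha' g hg, hb' g hg]
  rw [ep, eq] at hpZ hpT ⊢
  rw [ep] at haZ haT
  rw [eq] at hbZ hbT
  generalize fderiv ℝ a g (Z S.N g) = aZ at *
  generalize fderiv ℝ a g (tanT S.N g) = aT at *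
  generalize fderiv ℝ b g (Z S.N g) = bZ at *
  generalize fderiv ℝ b g (tanT S.N g) = bT at *
  generalize fderiv ℝ h g (Z S.N g) = hZ at *
  generalize fderiv ℝ h g (tanT S.N g) = hT at *
  generalize fderiv ℝ (pbar n) g (Z S.N g) = pZ at *
  generalize fderiv ℝ (pbar n) g (tanT S.N g) = pT at *
  generalize fderiv ℝ (qbar n) g (Z S.N g) = qZ at *
  generalize fderiv ℝ (qbar n) g (tanT S.N g) = qT at *
  generalize pbar S.N g = p at *
  generalize qbar S.N g = q at *
  generalize ombar S.N g = w at *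
  generalize h g = η at *
  have e1 : p * aZ + q * bZ = hZ := by
    rw [haZ, hbZ]; linear_combination hZ * hpq + η * hpZ
  have e2 : p * bT - q * aT = η * (p * qT - q * pT) := by
    rw [haT, hbT]; ring
  -- Lagrange's identity in the plane: the zeroth-order vector `-(p̄, q̄)` is a unit vector, so the
  -- left side is the square of its determinant with the first-order vector, namely of `-(Zh + ω̄
  -- h)`.
  have e3 : (bZ + η * w * q) ^ 2 + (-(η * w * p) - aZ) ^ 2
      - (-p * (bZ + η * w * q) + -q * (-(η * w * p) - aZ)) ^ 2 = (hZ + η * w) ^ 2 := by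
    rw [← e1]
    linear_combination (-((bZ + η * w * q) ^ 2 + (-(η * w * p) - aZ) ^ 2)
      + η * w * (2 * (p * aZ + q * bZ) + η * w * (p ^ 2 + q ^ 2 + 1))) * hpq
  -- The `Z`-derivatives drop out since their contribution is orthogonal to `(p̄, q̄)`.
  have e4 : 2 * (-p * (-p * (η * q * aT - η * p * bT) / 2 - η * bT
        + (η * q * aZ - η * p * bZ) * w * q / 2)
      + -q * (-q * (η * q * aT - η * p * bT) / 2 + η * aT
        - (η * q * aZ - η * p * bZ) * w * p / 2)) = η ^ 2 * (p * qT - q * pT) := by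
    linear_combination (-η * (p * bT - q * aT)) * hpq + η * e2
  -- The exact form `d(ha) ∧ dx + d(hb) ∧ dy`: it removes the mixed term `2 ω̄ h Zh` and supplies
  -- the second copy of `h² (p̄ τq̄ - q̄ τp̄)`, with `τ = T - ω̄ Y`.
  have e5 : (η * aZ + η * p * hZ) * -(w * p) - (η * aT + η * p * hT) * q
      + ((η * bZ + η * q * hZ) * -(w * q) - (η * bT + η * q * hT) * -p)
      = -2 * w * η * hZ + η ^ 2 * (p * qT - q * pT) := by
    linear_combination (-w * η) * e1 - w * η * hZ * hpq + η * e2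
  linear_combination -e3 - e4 - e5

theorem continuousOn_normalCoeff (hchar : S.charLocus = ∅) (ha : ContDiff ℝ 1 a)
    (hb : ContDiff ℝ 1 b) (hh : ContDiff ℝ 1 h) :
    ContinuousOn (normalCoeff₁ S a b h) S.carrier ∧
      ContinuousOn (normalCoeff₂ S a b h) S.carrier := by
  have hp := continuousOn_pbar hchar
  have hq := continuousOn_qbar hchar
  have hw := continuousOn_ombar hchar
  have hd : ∀ {f : Heis → ℝ}, ContDiff ℝ 1 f → ∀ {V : Heis → Heis}, ContinuousOn V S.carrier →
      ContinuousOn (fun g => fderiv ℝ f g (V g)) S.carrier := fun hf _ hV =>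
    (hf.continuous_fderiv (by norm_num)).continuousOn.clm_apply hV
  have haZ := hd ha (continuousOn_Z hchar)
  have haT := hd ha (continuousOn_tanT hchar)
  have hbZ := hd hb (continuousOn_Z hchar)
  have hbT := hd hb (continuousOn_tanT hchar)
  have ha0 := ha.continuous.continuousOn (s := S.carrier)
  have hb0 := hb.continuous.continuousOn (s := S.carrier)
  have hh0 := hh.continuous.continuousOn (s := S.carrier)
  constructor <;> rw [continuousOn_pi] <;> intro i <;> fin_cases i <;>
    simp only [normalCoeff₁, normalCoeff₂, Fin.reduceFinMk, Matrix.cons_val_zero,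
      Matrix.cons_val_one, Matrix.cons_val, Fin.zero_eta, Fin.mk_one, Fin.isValue] <;>
    fun_prop

theorem normalCoeff_zero (hchar : S.charLocus = ∅) {g : Heis} (hg : g ∈ S.carrier) :
    normalCoeff₁ S a b h g 0 ^ 2 + normalCoeff₂ S a b h g 0 ^ 2 = 1 := by
  simp [normalCoeff₁, normalCoeff₂, pbar_sq_add_qbar_sq (hlen_ne_zero hchar hg)]

/-- Off `K` the tangential derivatives of `a` and `b` vanish too, and the cubics reduce to the
constants `-p̄` and `-q̄`. -/
theorem jac_eq_one_of_notMem (hchar : S.charLocus = ∅) (ha : ContDiff ℝ 1 a)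
    (hb : ContDiff ℝ 1 b) (ha' : ∀ g ∈ S.carrier, a g = h g * pbar S.N g)
    (hb' : ∀ g ∈ S.carrier, b g = h g * qbar S.N g) {K : Set Heis} (hK : IsClosed K)
    (hsupp : ∀ g ∈ S.carrier \ K, h g = 0) (s : ℝ) {g : Heis} (hg : g ∈ S.carrier \ K) :
    jac S a b h s g = 1 := by
  have ha0 : ∀ x ∈ S.carrier \ K, a x = 0 := fun x hx => by rw [ha' x hx.1, hsupp x hx, zero_mul]
  have hb0 : ∀ x ∈ S.carrier \ K, b x = 0 := fun x hx => by rw [hb' x hx.1, hsupp x hx, zero_mul]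
  obtain ⟨h1, h2⟩ := fderiv_eq_zero_of_notMem hchar hK ha ha0 hg
  obtain ⟨h3, h4⟩ := fderiv_eq_zero_of_notMem hchar hK hb hb0 hg
  simp [jac, cubic, normalCoeff₁, normalCoeff₂, h1, h2, h3, h4, ha0 g hg, hb0 g hg, hsupp g hg,
    pbar_sq_add_qbar_sq (hlen_ne_zero hchar hg.1)]

theorem integrand_eq_integrand' {g : Heis} (hg : g ∈ S.carrier) :
    S.integrand h g = S.integrand' h g := by
  obtain ⟨O, hgO, hO⟩ := S.defining_spec hg
  have ew : ombar (S.normalNear g) g = ombar S.N g := ombar_congr (hO.normal_eq g ⟨hg, hgO⟩).symm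
  rw [integrand, integrand', OrientedSurface.calA, Heis.calA, ew]
  ring

/-- By its definition `calA` uses a defining function chosen separately at each point, so its
continuity is not apparent. It is read off from the right side of `second_variation_pointwise`. -/
theorem integrableOn_integrand_of_extension (hchar : S.charLocus = ∅) {K : Set Heis}
    (hK : IsCompact K) (hKS : K ⊆ S.carrier) (hfin : hPerimeter S.carrier K < ⊤)
    (ha : ContDiff ℝ 1 a) (hb : ContDiff ℝ 1 b) (hh : ContDiff ℝ 1 h)
    (ha' : ∀ g ∈ S.carrier, a g = h g * pbar S.N g)
    (hb' : ∀ g ∈ S.carrier, b g = h g * qbar S.N g) (hsupp : ∀ g ∈ S.carrier \ K, h g = 0) :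
    IntegrableOn (S.integrand h) S.carrier (hPerimeter S.carrier) := by
  obtain ⟨hX, hY⟩ := continuousOn_normalCoeff hchar ha hb hh
  have hX := continuousOn_pi.1 hX
  have hY := continuousOn_pi.1 hY
  refine integrableOn_of_continuousOn hK hfin (ContinuousOn.mono ?_ hKS) fun g hg => ?_
  · refine ContinuousOn.congr ?_ fun g hg =>
      second_variation_pointwise hchar ha hb hh ha' hb' hg
    exact ((((((hX 1).pow 2).add ((hY 1).pow 2)).add (continuousOn_const.mul
      (((hX 0).mul (hX 2)).add ((hY 0).mul (hY 2))))).sub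
      ((((hX 0).mul (hX 1)).add ((hY 0).mul (hY 1))).pow 2))).add
      ((continuousOn_bracket hchar (hh.mul ha) _).add
        (continuousOn_bracket hchar (hh.mul hb) _))
  · rw [integrand, along, (fderiv_eq_zero_of_notMem hchar hK.isClosed hh hsupp hg).1,
      hsupp g hg]
    ring

/-- The `H`-perimeter of a deformed surface is the integral of the Jacobian. -/
theorem eventually_deformedPerimeter_eq (hchar : S.charLocus = ∅) {K : Set Heis}
    (hK : IsCompact K) (hKS : K ⊆ S.carrier) (ha : ContDiff ℝ 1 a) (hb : ContDiff ℝ 1 b)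
    (hh : ContDiff ℝ 1 h) (hac : HasCompactSupport a) (hbc : HasCompactSupport b)
    (ha' : ∀ g ∈ S.carrier, a g = h g * pbar S.N g)
    (hb' : ∀ g ∈ S.carrier, b g = h g * qbar S.N g) (hsupp : ∀ g ∈ S.carrier \ K, h g = 0)
    {E : Set Heis} (hE : MeasurableSet E) (hES : E ⊆ S.carrier) (hKE : K ⊆ E)
    (hfin : hPerimeter S.carrier E < ⊤)
    (hpos : ∀ᶠ s in 𝓝 (0 : ℝ), ∀ g ∈ K, 0 < jac S a b h s g) :
    ∀ᶠ s in 𝓝 (0 : ℝ), S.deformedPerimeter h E s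
      = hPerimeter S.carrier (E \ K)
        + ENNReal.ofReal (∫ g in K, jac S a b h s g ∂(hPerimeter S.carrier)) := by
  have hKm := hK.measurableSet
  obtain ⟨hX, hY⟩ := continuousOn_normalCoeff hchar ha hb hh
  have hX := continuousOn_pi.1 hX
  have hY := continuousOn_pi.1 hY
  filter_upwards [hpos, eventually_exists_diffeo (contDiff_hfield ha hb)
    (hasCompactSupport_hfield hac hbc)] with s hs ⟨e, hes, he, he'⟩
  have hjc : ContinuousOn (jac S a b h s) S.carrier := by
    have hcub : ∀ {x : Heis → Fin 4 → ℝ}, (∀ i, ContinuousOn (fun g => x g i) S.carrier) →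
        ContinuousOn (fun g => cubic (x g) s) S.carrier := fun hx =>
      (((hx 0).add ((hx 1).mul continuousOn_const)).add ((hx 2).mul continuousOn_const)).add
        ((hx 3).mul continuousOn_const)
    exact (((hcub hX).pow 2).add ((hcub hY).pow 2)).sqrt
  have hj1 : ∀ g ∈ S.carrier \ K, jac S a b h s g = 1 := fun g hg =>
    jac_eq_one_of_notMem hchar ha hb ha' hb' hK.isClosed hsupp s hg
  have hjpos : ∀ g ∈ S.carrier, 0 < jac S a b h s g := by
    intro g hg
    by_cases hgK : g ∈ K
    · exact hs g hgK
    · rw [hj1 g ⟨hg, hgK⟩]; exact one_pos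
  have hdef : ∀ A ⊆ S.carrier, S.deform h s '' A = e '' A := fun A hA => by
    refine image_congr fun g hg => ?_
    rw [hes, deform, hfield, Y, ha' g (hA hg), hb' g (hA hg)]
    module
  classical
  -- The value 1 off `S` makes the density measurable, finite and nonzero on the whole space.
  set J : Heis → ℝ≥0∞ := S.carrier.piecewise (fun g => ENNReal.ofReal (jac S a b h s g)) 1 with hJ
  have hJS : ∀ g ∈ S.carrier, J g = ENNReal.ofReal (jac S a b h s g) := fun g hg =>
    piecewise_eq_of_mem _ _ _ hg
  have hJS' : ∀ g ∉ S.carrier, J g = 1 := fun g hg => piecewise_eq_of_notMem _ _ _ hg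
  have hJm : Measurable J :=
    ContinuousOn.measurable_piecewise (ENNReal.continuous_ofReal.comp_continuousOn hjc)
      continuousOn_const S.measurableSet_carrier
  rw [deformedPerimeter, hdef _ subset_rfl, hdef _ hES,
    hPerimeter_image e he he' hJm ?_ ?_ ?_ hE]
  · have hsplit : E = (E \ K) ∪ K := (sdiff_union_of_subset hKE).symm
    conv_lhs => rw [hsplit]
    rw [lintegral_union hKm disjoint_sdiff_left]
    congr 1
    · rw [setLIntegral_congr_fun (hE.diff hKm) (g := fun _ => 1), setLIntegral_one]
      intro g hg
      have hgS : g ∈ S.carrier := hES hg.1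
      simp only
      rw [hJS g hgS, hj1 g ⟨hgS, hg.2⟩, ENNReal.ofReal_one]
    · rw [setLIntegral_congr_fun hKm fun g hg => hJS g (hKS hg),
        ofReal_integral_eq_lintegral_ofReal]
      · obtain ⟨C, hC⟩ := hK.exists_bound_of_continuousOn (hjc.mono hKS)
        exact IntegrableOn.of_bound ((measure_mono hKE).trans_lt hfin)
          ((hjc.mono hKS).aestronglyMeasurable hKm) C
          ((ae_restrict_iff' hKm).2 (Eventually.of_forall hC))
      · exact Eventually.of_forall fun g => Real.sqrt_nonneg _
  · intro g
    by_cases hg : g ∈ S.carrier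
    · rw [hJS g hg]
      exact (ENNReal.ofReal_pos.2 (hjpos g hg)).ne'
    · rw [hJS' g hg]; exact one_ne_zero
  · intro g
    by_cases hg : g ∈ S.carrier
    · rw [hJS g hg]; exact ENNReal.ofReal_ne_top
    · rw [hJS' g hg]; exact ENNReal.one_ne_top
  · intro c u hu
    rw [hlen_normal_push hchar ha hb ha' hb' hes he he' (mapsTo_image e S.carrier) c hu,
      hJS _ (c.mapsTo hu), ENNReal.ofReal_mul (hjpos _ (c.mapsTo hu)).le]

end OrientedSurface

end Heis

/-! ### The second variation formula -/

open Heis OrientedSurface in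
theorem lemma3p8 (S : Heis.OrientedSurface 3) (hchar : S.charLocus = ∅)
    -- a function on `S` of class `C²`, given by an extension to `ℝ³`, ...
    (h : Heis → ℝ) (hh : ContDiff ℝ 2 h)
    -- ... whose restriction to `S` is supported in a compact subset `K` of `S`
    (K : Set Heis) (hK : IsCompact K) (hKS : K ⊆ S.carrier)
    (hsupp : ∀ g ∈ S.carrier \ K, h g = 0)
    -- a Borel part `E` of `S` of finite `H`-perimeter that contains the support
    -- (all of `S`, if `S` has finite `H`-perimeter)
    (E : Set Heis) (hE : MeasurableSet E) (hES : E ⊆ S.carrier) (hKE : K ⊆ E)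
    (hfin : Heis.hPerimeter S.carrier E < ⊤) :
    (∀ᶠ s in 𝓝 (0 : ℝ), S.deformedPerimeter h E s < ⊤) ∧
    IntegrableOn (S.integrand h) S.carrier (Heis.hPerimeter S.carrier) ∧
    Heis.HasSecondDerivAt (fun s => (S.deformedPerimeter h E s).toReal)
      (∫ g in S.carrier, S.integrand h g ∂(Heis.hPerimeter S.carrier)) 0 ∧
    ∫ g in S.carrier, S.integrand h g ∂(Heis.hPerimeter S.carrier) =
      ∫ g in S.carrier, S.integrand' h g ∂(Heis.hPerimeter S.carrier) := by
  obtain ⟨a, b, ha2, hb2, hac, hbc, ha', hb'⟩ := exists_field_extension hchar hh hK hKS hsupp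
  have ha : ContDiff ℝ 1 a := ha2.of_le (by norm_num)
  have hb : ContDiff ℝ 1 b := hb2.of_le (by norm_num)
  have hh1 : ContDiff ℝ 1 h := hh.of_le (by norm_num)
  have hfinK : hPerimeter S.carrier K < ⊤ := (measure_mono hKE).trans_lt hfin
  have hfinEK : hPerimeter S.carrier (E \ K) < ⊤ := (measure_mono sdiff_subset).trans_lt hfin
  obtain ⟨hX, hY⟩ := continuousOn_normalCoeff hchar ha hb hh1
  obtain ⟨hpos, hder⟩ := hasSecondDerivAt_integral_sqrt_normSq hK hfinK (hX.mono hKS)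
    (hY.mono hKS) fun g hg => normalCoeff_zero hchar (hKS hg)
  have hev := eventually_deformedPerimeter_eq hchar hK hKS ha hb hh1 hac hbc ha' hb' hsupp hE hES
    hKE hfin (hpos.mono fun s hs g hg => Real.sqrt_pos.2 (hs g hg))
  have hint := integrableOn_integrand_of_extension hchar hK hKS hfinK ha hb hh1 ha' hb' hsupp
  refine ⟨?_, hint, ?_, setIntegral_congr_fun S.measurableSet_carrier
    fun g hg => integrand_eq_integrand' hg⟩
  · filter_upwards [hev] with s hs
    rw [hs]
    exact ENNReal.add_lt_top.2 ⟨hfinEK, ENNReal.ofReal_lt_top⟩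
  · have hstokes : ∀ {f : Heis → ℝ}, ContDiff ℝ 1 f → ∀ l : Heis →L[ℝ] ℝ,
        IntegrableOn (bracket S (fun x => h x * f x) l) S.carrier (hPerimeter S.carrier) ∧
        ∫ g in S.carrier, bracket S (fun x => h x * f x) l g ∂(hPerimeter S.carrier) = 0 := by
      intro f hf l
      have h0 : ∀ g ∈ S.carrier \ K, h g * f g = 0 := fun g hg => by rw [hsupp g hg, zero_mul]
      exact ⟨integrableOn_of_continuousOn hK hfinK
        ((continuousOn_bracket hchar (hh1.mul hf) l).mono hKS)
        fun g hg => bracket_eq_zero_of_notMem hchar hK.isClosed (hh1.mul hf) h0 l hg,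
        integral_bracket_eq_zero hchar hK hKS hfinK (hh1.mul hf) h0 l⟩
    obtain ⟨i₁, z₁⟩ := hstokes ha (ContinuousLinearMap.fst ℝ ℝ (ℝ × ℝ))
    obtain ⟨i₂, z₂⟩ := hstokes hb
      ((ContinuousLinearMap.fst ℝ ℝ ℝ).comp (ContinuousLinearMap.snd ℝ ℝ (ℝ × ℝ)))
    have hval : ∫ g in S.carrier, S.integrand h g ∂(hPerimeter S.carrier)
        = ∫ g in K, (normalCoeff₁ S a b h g 1 ^ 2 + normalCoeff₂ S a b h g 1 ^ 2
          + 2 * (normalCoeff₁ S a b h g 0 * normalCoeff₁ S a b h g 2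
            + normalCoeff₂ S a b h g 0 * normalCoeff₂ S a b h g 2)
          - (normalCoeff₁ S a b h g 0 * normalCoeff₁ S a b h g 1
            + normalCoeff₂ S a b h g 0 * normalCoeff₂ S a b h g 1) ^ 2)
          ∂(hPerimeter S.carrier) := by
      have hpt := fun g hg => second_variation_pointwise hchar ha hb hh1 ha' hb' (g := g) hg
      -- Subtracting the two exact terms, of integral zero, leaves the second derivative of the
      -- density.
      have h1 : ∫ g in S.carrier, S.integrand h g ∂(hPerimeter S.carrier)
          = ∫ g in S.carrier, (S.integrand h g
            - (bracket S (fun x => h x * a x) (ContinuousLinearMap.fst ℝ ℝ (ℝ × ℝ)) g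
              + bracket S (fun x => h x * b x) ((ContinuousLinearMap.fst ℝ ℝ ℝ).comp
                (ContinuousLinearMap.snd ℝ ℝ (ℝ × ℝ))) g)) ∂(hPerimeter S.carrier) := by
        have h2 := integral_sub hint (i₁.add i₂)
        have h3 := integral_add i₁ i₂
        rw [z₁, z₂, add_zero] at h3
        simp only [Pi.add_apply] at h2
        rw [h2, h3, sub_zero]
      rw [h1, setIntegral_eq_of_subset_of_forall_sdiff_eq_zero S.measurableSet_carrier hKS]
      · exact setIntegral_congr_fun hK.measurableSet fun g hg => by
          rw [hpt g (hKS hg)]; ring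
      · intro g hg
        have hz : ∀ {f : Heis → ℝ}, ContDiff ℝ 1 f → ∀ l : Heis →L[ℝ] ℝ,
            bracket S (fun x => h x * f x) l g = 0 := fun hf l =>
          bracket_eq_zero_of_notMem hchar hK.isClosed (hh1.mul hf)
            (fun x hx => by rw [hsupp x hx, zero_mul]) l hg
        rw [hz ha, hz hb, integrand, along,
          (fderiv_eq_zero_of_notMem hchar hK.isClosed hh1 hsupp hg).1, hsupp g hg]
        ring
    rw [hval]
    -- The part of `E` outside `K` does not move and contributes a finite constant.
    refine hder.const_add_congr (hPerimeter S.carrier (E \ K)).toReal ?_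
    filter_upwards [hev] with s hs
    have hnn : 0 ≤ ∫ g in K, jac S a b h s g ∂(hPerimeter S.carrier) :=
      integral_nonneg fun g => Real.sqrt_nonneg _
    rw [hs, ENNReal.toReal_add hfinEK.ne ENNReal.ofReal_ne_top, ENNReal.toReal_ofReal hnn]
    rfl
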